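/- Work in continuous logic. Let $L$ be a countable one-sorted continuous signature whose predicates, including the metric, take values in $[0,1]$; every symbol carries a modulus of uniform continuity, and $L$-structures are nonempty complete metric spaces of diameter at most $1$ with interpretations of the symbols that respect these moduli. $L$-formulas are built from atomic formulas by continuous connectives $[0,1]^k\to[0,1]$ and the quantifiers $\sup_x,\inf_x$; $L_{\omega_1,\omega}$-formulas allow in addition countable suprema $\bigvee_m\varphi_m$ and infima $\bigwedge_m\varphi_m$ of families of formulas in a common finite tuple of free variables that have a common modulus of uniform continuity (valid in all $L$-structures). An $L$-theory is a set of closed conditions $\sigma=r$ with $\sigma$ an $L$-sentence and $r\in[0,1]$. Let $T$ be a satisfiable $L$-theory. Let $C$ be a countably infinite set of new constant symbols. A *condition* is a finite set $p$ of expressions $\varphi<r$, with $r\in\mathbb R$ and $\varphi$ a quantifier-free $L(C)$-sentence built from atomic sentences using only the connectives $x\mapsto x/2$, $x\mapsto 1-x$ and $(x,y)\mapsto\min(x+y,1)$, such that $T\cup p$ is satisfiable. Two players $\forall$ and $\exists$ alternately play conditions $p_0\subseteq p_1\subseteq p_2\subseteq\cdots$, with $\forall$ starting; put $\bar p=\bigcup_n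 p_n$. The play is *definitive* if for every atomic $L(C)$-sentence $\varphi$ there is a unique $r\in[0,1]$ with $T\cup\bar p\models\varphi=r$; in that case these values define an $L(C)$-prestructure on the set of closed $L(C)$-terms, whose completion is the *compiled structure*. A property $P$ of $L(C)$-structures is *enforceable* if $\exists$ has a strategy such that every play in which $\exists$ follows it is definitive and has a compiled structure with property $P$. The *finite forcing companion* $T^f$ of $T$ is the $L$-theory of all closed conditions $\sigma=r$, with $\sigma$ an $L$-sentence and $r\in[0,1]$, such that the property "$\sigma=r$ holds in the compiled structure" is enforceable. **Theorem.** Suppose that $T$ has the joint embedding property, i.e. any two models of $T$ embed into a common model of $T$. Then for every $L_{\omega_1,\omega}$-sentence $\varphi$ there is a unique $r\in[0,1]$ such that $\varphi=r$ is enforceable. Consequently $T^f$ is complete, i.e. $T^f$ is the set of all closed conditions $\sigma=r$ that hold in some $L$-structure $M$. -/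

import Mathlib

universe u

namespace ContLogic

open unitInterval

/-! ### Moduli of uniform continuity and continuous signatures -/

/-- A modulus of uniform continuity: a function `ε ↦ δ(ε)` with `δ(ε) > 0` for `ε > 0`. -/
structure Modulus where
  toFun : ℝ → ℝ
  pos : ∀ ε, 0 < ε → 0 < toFun ε

/-- `f` is uniformly continuous with modulus `δ`. -/
def Modulus.Respects {X Y : Type*} [PseudoMetricSpace X] [PseudoMetricSpace Y]
    (δ : Modulus) (f : X → Y) : Prop :=
  ∀ ε, 0 < ε → ∀ x y, dist x y < δ.toFun ε → dist (f x) (f y) ≤ ε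

/-- A one-sorted continuous signature (constant symbols are function symbols of arity `0`).
Every symbol comes with its modulus of uniform continuity; predicates, including the metric,
take values in `[0,1]`. -/
structure Signature : Type (u + 1) where
  Func : ℕ → Type u
  Pred : ℕ → Type u
  funcMod : ∀ {n}, Func n → Modulus
  predMod : ∀ {n}, Pred n → Modulus

/-- A signature is countable if it has countably many symbols. -/
class Signature.IsCountable (L : Signature.{u}) : Prop where
  func : ∀ n, Countable (L.Func n)
  pred : ∀ n, Countable (L.Pred n)

/-! ### Prestructures and structures -/

/-- An `L`-prestructure: a nonempty pseudometric space of diameter at most `1` with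
interpretations of the symbols that respect their moduli. (`Fin n → M` carries the maximum
metric.) -/
structure Prestructure (L : Signature.{u}) : Type (u + 1) where
  carrier : Type u
  [pseudoMetric : PseudoMetricSpace carrier]
  [nonempty : Nonempty carrier]
  dist_le_one : ∀ x y : carrier, dist x y ≤ 1
  func : ∀ {n}, L.Func n → (Fin n → carrier) → carrier
  pred : ∀ {n}, L.Pred n → (Fin n → carrier) → I
  func_unif : ∀ {n} (f : L.Func n), (L.funcMod f).Respects (func f)
  pred_unif : ∀ {n} (R : L.Pred n), (L.predMod R).Respects (pred R)

/-- An `L`-structure: as a prestructure, but on a complete metric space. -/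
structure Struct (L : Signature.{u}) : Type (u + 1) where
  carrier : Type u
  [metric : MetricSpace carrier]
  [complete : CompleteSpace carrier]
  [nonempty : Nonempty carrier]
  dist_le_one : ∀ x y : carrier, dist x y ≤ 1
  func : ∀ {n}, L.Func n → (Fin n → carrier) → carrier
  pred : ∀ {n}, L.Pred n → (Fin n → carrier) → I
  func_unif : ∀ {n} (f : L.Func n), (L.funcMod f).Respects (func f)
  pred_unif : ∀ {n} (R : L.Pred n), (L.predMod R).Respects (pred R)

attribute [instance] Prestructure.pseudoMetric Prestructure.nonempty
attribute [instance] Struct.metric Struct.complete Struct.nonempty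

/-- The metric of a structure as a `[0,1]`-valued predicate. -/
def Struct.idist {L : Signature.{u}} (M : Struct L) (x y : M.carrier) : I :=
  ⟨dist x y, dist_nonneg, M.dist_le_one x y⟩

/-- An embedding of `L`-structures: an isometry that preserves all symbols. -/
structure Embedding {L : Signature.{u}} (M N : Struct L) where
  toFun : M.carrier → N.carrier
  isometry : Isometry toFun
  map_func : ∀ {n} (f : L.Func n) (a : Fin n → M.carrier),
    toFun (M.func f a) = N.func f (fun i => toFun (a i))
  map_pred : ∀ {n} (R : L.Pred n) (a : Fin n → M.carrier),
    N.pred R (fun i => toFun (a i)) = M.pred R a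

/-! ### The completion of a prestructure -/

section Completion

open UniformSpace (Completion)

variable {X : Type u} [PseudoMetricSpace X] {Y : Type*} [MetricSpace Y]

/-- The canonical map of `X ^ n` into the `n`-th power of the completion of `X`. -/
def toCompletionPow (X : Type u) [PseudoMetricSpace X] (n : ℕ) (a : Fin n → X) :
    Fin n → Completion X :=
  fun i => (a i : Completion X)

theorem toCompletionPow_isometry (n : ℕ) : Isometry (toCompletionPow X n) := by
  refine Isometry.of_dist_eq fun a b => ?_
  simp only [dist_pi_def, toCompletionPow, nndist_dist, Completion.dist_eq]

theorem toCompletionPow_denseRange (n : ℕ) : DenseRange (toCompletionPow X n) :=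
  DenseRange.piMap (f := fun (_ : Fin n) (x : X) => (x : Completion X))
    fun _ => Completion.denseRange_coe

theorem toCompletionPow_isDenseInducing (n : ℕ) : IsDenseInducing (toCompletionPow X n) :=
  (toCompletionPow_isometry n).isUniformInducing.isDenseInducing (toCompletionPow_denseRange n)

/-- The extension by continuity of a map on `X ^ n` to the `n`-th power of the completion. -/
noncomputable def extendPow {n : ℕ} (f : (Fin n → X) → Y) : (Fin n → Completion X) → Y :=
  (toCompletionPow_isDenseInducing n).extend f

theorem Modulus.Respects.uniformContinuous {δ : Modulus} {Z W : Type*} [PseudoMetricSpace Z]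
    [PseudoMetricSpace W] {f : Z → W} (h : δ.Respects f) : UniformContinuous f := by
  rw [Metric.uniformContinuous_iff]
  intro ε hε
  refine ⟨δ.toFun (ε / 2), δ.pos _ (half_pos hε), fun {a b} hab => ?_⟩
  exact (h (ε / 2) (half_pos hε) a b hab).trans_lt (half_lt_self hε)

theorem extendPow_coe {n : ℕ} {δ : Modulus} {f : (Fin n → X) → Y} (h : δ.Respects f)
    (a : Fin n → X) : extendPow f (toCompletionPow X n a) = f a :=
  uniformly_extend_of_ind (toCompletionPow_isometry n).isUniformInducing
    (toCompletionPow_denseRange n) h.uniformContinuous a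

theorem extendPow_respects [CompleteSpace Y] {n : ℕ} {δ : Modulus} {f : (Fin n → X) → Y} (h : δ.Respects f) :
    δ.Respects (extendPow f) := by
  intro ε hε x y hxy
  have hc : Continuous (extendPow f) :=
    (uniformContinuous_uniformly_extend (toCompletionPow_isometry n).isUniformInducing
      (toCompletionPow_denseRange n) h.uniformContinuous).continuous
  let U : Set ((Fin n → Completion X) × (Fin n → Completion X)) := {z | dist z.1 z.2 < δ.toFun ε}
  have hU : IsOpen U := isOpen_lt (by fun_prop) continuous_const
  have hd : Dense (Set.range (Prod.map (toCompletionPow X n) (toCompletionPow X n))) :=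
    (toCompletionPow_denseRange n).prodMap (toCompletionPow_denseRange n)
  have hcl : IsClosed {z : (Fin n → Completion X) × (Fin n → Completion X) |
      dist (extendPow f z.1) (extendPow f z.2) ≤ ε} :=
    isClosed_le (by fun_prop) continuous_const
  have hmem : (x, y) ∈ closure
      (U ∩ Set.range (Prod.map (toCompletionPow X n) (toCompletionPow X n))) :=
    hd.open_subset_closure_inter hU hxy
  refine closure_minimal ?_ hcl hmem
  rintro _ ⟨hz, ⟨⟨a, b⟩, rfl⟩⟩
  have hab : dist a b < δ.toFun ε := by
    rw [← (toCompletionPow_isometry (X := X) n).dist_eq]; exact hz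
  simpa [extendPow_coe h] using h ε hε a b hab

/-- The completion of a prestructure: the metric completion of (the metric quotient of) its
universe, with all symbols extended by continuity. -/
noncomputable def Prestructure.completion {L : Signature.{u}} (A : Prestructure L) : Struct L where
  carrier := Completion A.carrier
  nonempty := ⟨((Classical.arbitrary A.carrier : A.carrier) : Completion A.carrier)⟩
  dist_le_one x y := by
    refine Completion.induction_on₂ x y (isClosed_le (by fun_prop) continuous_const) ?_
    intro a b
    rw [Completion.dist_eq]
    exact A.dist_le_one a b
  func f := extendPow (fun a => (A.func f a : Completion A.carrier))
  pred R := extendPow (A.pred R)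
  func_unif f := extendPow_respects fun ε hε a b hab => by
    rw [Completion.dist_eq]
    exact A.func_unif f ε hε a b hab
  pred_unif R := extendPow_respects (A.pred_unif R)

end Completion

/-! ### Terms and formulas -/

/-- Terms with variables among `x₀, …, xₙ₋₁`. -/
inductive Term (L : Signature.{u}) (n : ℕ) : Type u
  | var (i : Fin n) : Term L n
  | app {k : ℕ} (f : L.Func k) (ts : Fin k → Term L n) : Term L n

/-- Atomic formulas with variables among `x₀, …, xₙ₋₁`. -/
inductive Atomic (L : Signature.{u}) (n : ℕ) : Type u
  | dist (s t : Term L n) : Atomic L n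
  | pred {k : ℕ} (R : L.Pred k) (ts : Fin k → Term L n) : Atomic L n

/-- Raw infinitary formulas with free variables among `x₀, …, xₙ₋₁`: built from atomic formulas by
continuous connectives `[0,1]^k → [0,1]`, the quantifiers `sup` and `inf` (over the last
variable), and countable suprema and infima. -/
inductive PreFormula (L : Signature.{u}) : ℕ → Type u
  | atomic {n : ℕ} (α : Atomic L n) : PreFormula L n
  | conn {n k : ℕ} (c : C(Fin k → I, I)) (φ : Fin k → PreFormula L n) : PreFormula L n
  | sup {n : ℕ} (φ : PreFormula L (n + 1)) : PreFormula L n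
  | inf {n : ℕ} (φ : PreFormula L (n + 1)) : PreFormula L n
  | bigSup {n : ℕ} (φ : ℕ → PreFormula L n) : PreFormula L n
  | bigInf {n : ℕ} (φ : ℕ → PreFormula L n) : PreFormula L n

section Semantics

variable {L : Signature.{u}}

/-- The value of a term in a structure. -/
def Term.val (M : Struct L) {n : ℕ} (a : Fin n → M.carrier) : Term L n → M.carrier
  | .var i => a i
  | .app f ts => M.func f (fun i => (ts i).val M a)

/-- The value of an atomic formula in a structure. -/
def Atomic.val (M : Struct L) {n : ℕ} (a : Fin n → M.carrier) : Atomic L n → I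
  | .dist s t => M.idist (s.val M a) (t.val M a)
  | .pred R ts => M.pred R (fun i => (ts i).val M a)

/-- The value of a formula in a structure. -/
noncomputable def PreFormula.val (M : Struct L) :
    {n : ℕ} → PreFormula L n → (Fin n → M.carrier) → I
  | _, .atomic α, a => α.val M a
  | _, .conn c φ, a => c (fun i => (φ i).val M a)
  | n, .sup φ, a => ⨆ x : M.carrier, φ.val M (Fin.snoc (α := fun _ : Fin (n + 1) => M.carrier) a x)
  | n, .inf φ, a => ⨅ x : M.carrier, φ.val M (Fin.snoc (α := fun _ : Fin (n + 1) => M.carrier) a x)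
  | _, .bigSup φ, a => ⨆ m : ℕ, (φ m).val M a
  | _, .bigInf φ, a => ⨅ m : ℕ, (φ m).val M a

/-- The `φ m` have a common modulus of uniform continuity, valid in all `L`-structures. -/
def HaveCommonModulus {n : ℕ} (φ : ℕ → PreFormula L n) : Prop :=
  ∃ δ : Modulus, ∀ (m : ℕ) (M : Struct L), δ.Respects (fun a : Fin n → M.carrier => (φ m).val M a)

/-- The formulas of `L_{ω₁,ω}`: countable suprema and infima are formed only of families of
formulas with a common modulus of uniform continuity. -/
def PreFormula.IsInfFormula : {n : ℕ} → PreFormula L n → Prop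
  | _, .atomic _ => True
  | _, .conn _ φ => ∀ i, (φ i).IsInfFormula
  | _, .sup φ => φ.IsInfFormula
  | _, .inf φ => φ.IsInfFormula
  | _, .bigSup φ => (∀ m, (φ m).IsInfFormula) ∧ HaveCommonModulus φ
  | _, .bigInf φ => (∀ m, (φ m).IsInfFormula) ∧ HaveCommonModulus φ

/-- The (finitary) formulas of continuous logic. -/
def PreFormula.IsFinitary : {n : ℕ} → PreFormula L n → Prop
  | _, .atomic _ => True
  | _, .conn _ φ => ∀ i, (φ i).IsFinitary
  | _, .sup φ => φ.IsFinitary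
  | _, .inf φ => φ.IsFinitary
  | _, .bigSup _ => False
  | _, .bigInf _ => False

/-- The value of a raw sentence in a structure. -/
noncomputable def Struct.sval (M : Struct L) (φ : PreFormula L 0) : I := φ.val M Fin.elim0

end Semantics

/-- The sentences of `L_{ω₁,ω}`. -/
def InfSentence (L : Signature.{u}) : Type u := {φ : PreFormula L 0 // φ.IsInfFormula}

/-- The finitary `L`-sentences. -/
def Sentence (L : Signature.{u}) : Type u := {φ : PreFormula L 0 // φ.IsFinitary}

/-! ### Theories -/

/-- An `L`-theory: a set of closed conditions `σ = r`, coded as pairs `(σ, r)`. -/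
abbrev Theory (L : Signature.{u}) : Type u := Set (Sentence L × I)

/-- `M` is a model of `T`. -/
def Struct.Models {L : Signature.{u}} (M : Struct L) (T : Theory L) : Prop :=
  ∀ c ∈ T, M.sval c.1.1 = c.2

/-- The theory of a structure: all closed conditions that hold in it. -/
def Struct.theory {L : Signature.{u}} (M : Struct L) : Theory L := {c | M.sval c.1.1 = c.2}

/-- `T` has a model. -/
def Theory.IsSatisfiable {L : Signature.{u}} (T : Theory L) : Prop := ∃ M : Struct L, M.Models T

/-- `T` is complete: it is the theory of some structure. -/
def Theory.IsComplete {L : Signature.{u}} (T : Theory L) : Prop := ∃ M : Struct L, T = M.theory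

/-- The joint embedding property: any two models of `T` embed into a common model of `T`. -/
def Theory.JEP {L : Signature.{u}} (T : Theory L) : Prop :=
  ∀ M N : Struct L, M.Models T → N.Models T →
    ∃ K : Struct L, K.Models T ∧ Nonempty (Embedding M K) ∧ Nonempty (Embedding N K)

/-! ### New constants -/

/-- The function symbols of `L(C)`. -/
inductive FuncWith (L : Signature.{u}) (C : Type u) : ℕ → Type u
  | old {n : ℕ} (f : L.Func n) : FuncWith L C n
  | const (c : C) : FuncWith L C 0

/-- The signature `L(C)`: `L` together with a new constant symbol for every element of `C`. -/
def Signature.withConsts (L : Signature.{u}) (C : Type u) : Signature.{u} where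
  Func := FuncWith L C
  Pred := L.Pred
  funcMod
    | .old f => L.funcMod f
    | .const _ => ⟨fun _ => 1, fun _ _ => one_pos⟩
  predMod := L.predMod

/-- The reduct to `L` of an `L(C)`-structure. -/
def Struct.reduct {L : Signature.{u}} {C : Type u} (M : Struct (L.withConsts C)) : Struct L where
  carrier := M.carrier
  dist_le_one := M.dist_le_one
  func f := M.func (.old f : FuncWith L C _)
  pred {n} R := M.pred (n := n) R
  func_unif f := M.func_unif (.old f : FuncWith L C _)
  pred_unif {n} R := M.pred_unif (n := n) R

/-! ### Conditions -/

/-- Restricted quantifier-free sentences: built from atomic sentences with the connectives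
`x ↦ x / 2`, `x ↦ 1 - x` and truncated addition. -/
inductive RSentence (L : Signature.{u}) : Type u
  | atomic (α : Atomic L 0) : RSentence L
  | half (φ : RSentence L) : RSentence L
  | neg (φ : RSentence L) : RSentence L
  | dotplus (φ ψ : RSentence L) : RSentence L

/-- The value of a restricted quantifier-free sentence in a structure. -/
noncomputable def RSentence.val {L : Signature.{u}} (M : Struct L) : RSentence L → ℝ
  | .atomic α => (α.val M Fin.elim0 : ℝ)
  | .half φ => φ.val M / 2
  | .neg φ => 1 - φ.val M
  | .dotplus φ ψ => min (φ.val M + ψ.val M) 1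

/-- A set of expressions `φ < r`, with `φ` a restricted quantifier-free `L(C)`-sentence. -/
abbrev OpenSet (L : Signature.{u}) (C : Type u) : Type u :=
  Set (RSentence (L.withConsts C) × ℝ)

/-- The `L(C)`-structure `M` is a model of `T ∪ p`. -/
def ModelsWith {L : Signature.{u}} {C : Type u} (T : Theory L) (p : OpenSet L C)
    (M : Struct (L.withConsts C)) : Prop :=
  M.reduct.Models T ∧ ∀ e ∈ p, e.1.val M < e.2

/-- A condition: a finite set `p` of expressions `φ < r` such that `T ∪ p` is satisfiable. -/
structure Condition {L : Signature.{u}} (T : Theory L) (C : Type u) : Type u where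
  expr : OpenSet L C
  finite : expr.Finite
  sat : ∃ M : Struct (L.withConsts C), ModelsWith T expr M

/-! ### The game -/

section Game

variable {L : Signature.{u}} {C : Type u} (T : Theory L)

/-- `T ∪ p ⊨ α = r`. -/
def Entails (p : OpenSet L C) (α : Atomic (L.withConsts C) 0) (r : I) : Prop :=
  ∀ M : Struct (L.withConsts C), ModelsWith T p M → α.val M Fin.elim0 = r

/-- `p` is definitive: every atomic `L(C)`-sentence has a unique value determined by `T ∪ p`. -/
def Definitive (p : OpenSet L C) : Prop :=
  ∀ α : Atomic (L.withConsts C) 0, ∃! r : I, Entails T p α r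

variable {T}

/-- The value of an atomic `L(C)`-sentence determined by a definitive `T ∪ p`. -/
noncomputable def Definitive.value {p : OpenSet L C} (h : Definitive T p)
    (α : Atomic (L.withConsts C) 0) : I :=
  (h α).choose

theorem Definitive.value_eq {p : OpenSet L C} (h : Definitive T p)
    (α : Atomic (L.withConsts C) 0) {M : Struct (L.withConsts C)} (hM : ModelsWith T p M) :
    h.value α = α.val M Fin.elim0 :=
  ((h α).choose_spec.1 M hM).symm

/-- The closed term given by a new constant. -/
def constTerm (L : Signature.{u}) {C : Type u} (c : C) : Term (L.withConsts C) 0 :=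
  .app (FuncWith.const c : FuncWith L C 0) Fin.elim0

theorem Definitive.exists_model [Nonempty C] {p : OpenSet L C} (h : Definitive T p) :
    ∃ M : Struct (L.withConsts C), ModelsWith T p M := by
  by_contra hne
  obtain ⟨c⟩ := ‹Nonempty C›
  have hE : ∀ r : I, Entails T p (.dist (constTerm L c) (constTerm L c)) r :=
    fun r M hM => absurd ⟨M, hM⟩ hne
  exact zero_ne_one (α := I) ((h _).unique (hE 0) (hE 1))

/-- The pseudometric on closed `L(C)`-terms determined by a definitive `T ∪ p`. -/
noncomputable abbrev Definitive.pseudoMetric [Nonempty C] {p : OpenSet L C} (h : Definitive T p) :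
    PseudoMetricSpace (Term (L.withConsts C) 0) where
  dist s t := (h.value (.dist s t) : ℝ)
  dist_self s := by
    obtain ⟨M, hM⟩ := h.exists_model
    simp [h.value_eq _ hM, Atomic.val, Struct.idist]
  dist_comm s t := by
    obtain ⟨M, hM⟩ := h.exists_model
    simp [h.value_eq _ hM, Atomic.val, Struct.idist, dist_comm]
  dist_triangle s t v := by
    obtain ⟨M, hM⟩ := h.exists_model
    simp only [h.value_eq _ hM, Atomic.val, Struct.idist]
    exact dist_triangle _ _ _

theorem Definitive.dist_pow_eq [Nonempty C] {p : OpenSet L C} (h : Definitive T p)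
    {M : Struct (L.withConsts C)} (hM : ModelsWith T p M) {n : ℕ}
    (a b : Fin n → Term (L.withConsts C) 0) :
    letI := h.pseudoMetric
    dist a b = dist (fun i => (a i).val M Fin.elim0) (fun i => (b i).val M Fin.elim0) := by
  let _ := h.pseudoMetric
  have key : ∀ s t : Term (L.withConsts C) 0,
      dist s t = dist (s.val M Fin.elim0) (t.val M Fin.elim0) := fun s t => by
    change (h.value (.dist s t) : ℝ) = _
    rw [h.value_eq _ hM]
    rfl
  simp only [dist_pi_def]
  congr 2
  funext i
  exact NNReal.eq (key (a i) (b i))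

/-- The prestructure described by a definitive `T ∪ p`: its universe is the algebra of closed
`L(C)`-terms, and the metric and the predicates take the values determined by `T ∪ p`. -/
noncomputable def Definitive.prestructure [Nonempty C] {p : OpenSet L C} (h : Definitive T p) :
    Prestructure (L.withConsts C) :=
  letI := h.pseudoMetric
  { carrier := Term (L.withConsts C) 0
    nonempty := ‹Nonempty C›.map (constTerm L)
    dist_le_one := fun s t => (h.value (.dist s t)).2.2
    func := fun f ts => .app f ts
    pred := fun R ts => h.value (.pred R ts)
    func_unif := fun f ε hε a b hab => by
      obtain ⟨M, hM⟩ := h.exists_model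
      rw [h.dist_pow_eq hM] at hab
      change (h.value (.dist (.app f a) (.app f b)) : ℝ) ≤ ε
      rw [h.value_eq _ hM]
      exact M.func_unif f ε hε _ _ hab
    pred_unif := fun R ε hε a b hab => by
      obtain ⟨M, hM⟩ := h.exists_model
      rw [h.dist_pow_eq hM] at hab
      change dist (h.value (.pred R a)) (h.value (.pred R b)) ≤ ε
      rw [h.value_eq _ hM, h.value_eq _ hM]
      exact M.pred_unif R ε hε _ _ hab }

/-- The compiled structure. -/
noncomputable def Definitive.compiled [Nonempty C] {p : OpenSet L C} (h : Definitive T p) :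
    Struct (L.withConsts C) :=
  h.prestructure.completion

variable (T)

/-- The play `p₀ ⊆ p₁ ⊆ ⋯` with union `p̄` is won by Player `∃` in the game `G(P)`. -/
def Wins [Nonempty C] (P : Struct (L.withConsts C) → Prop) (p : ℕ → Condition T C) : Prop :=
  ∃ h : Definitive T (⋃ n, (p n).expr), P h.compiled

/-- A strategy for Player `∃`: to every position `(p₀, …, pₖ)` it assigns a condition
extending `pₖ`. (Only positions with `k` even, where `∃` is to move, matter.) -/
structure Strategy (C : Type u) : Type u where
  move : (k : ℕ) → (Fin (k + 1) → Condition T C) → Condition T C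
  extends_last : ∀ k pos, (pos (Fin.last k)).expr ⊆ (move k pos).expr

/-- The property `P` of `L(C)`-structures is enforceable: Player `∃` has a winning strategy in
the game `G(P)`, in which `∀` chooses `p₀, p₂, …` and `∃` chooses `p₁, p₃, …`. -/
def Enforceable [Nonempty C] (P : Struct (L.withConsts C) → Prop) : Prop :=
  ∃ s : Strategy T C, ∀ p : ℕ → Condition T C,
    (∀ n, (p n).expr ⊆ (p (n + 1)).expr) →
    (∀ k, p (2 * k + 1) = s.move (2 * k) (fun i => p i)) →
    Wins T P p

/-- The finite forcing companion of `T` (computed with the set `C` of new constants): all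
closed conditions `σ = r`, with `σ` a finitary `L`-sentence, that are enforceable. -/
def finiteForcingCompanion (C : Type u) [Nonempty C] : Theory L :=
  {c | Enforceable T (fun A : Struct (L.withConsts C) => A.reduct.sval c.1.1 = c.2)}

end Game

end ContLogic

namespace ContLogic

open unitInterval Filter Topology

/-! ### Suprema and infima in the unit interval -/

/-! The argument is a topological zero-one law on the space of quantifier-free diagrams of
`L(C)`-structures that model `T`. Ultraproducts show that this space is closed in a power of
`[0,1]`, hence compact (`isClosed_diagrams`), and it is metrizable because there are countably many
atomic sentences. Conditions define nonempty open sets of diagrams, and the game is a Banach–Mazur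
game: by shrinking to small closed sets inside prescribed dense open sets, Player `∃` steers the
play to a single diagram in any given residual set (`enforceable_of_mem_residual`).

The closed terms are countable in number and dense in the compiled structure, so quantifiers may
range over closed terms. The value of an infinitary sentence is thus a Borel function of the diagram
(`PreFormula.measurable_termVal`), and it is invariant under permutations of `C`, since the sentence
mentions no new constants. The joint embedding property makes these permutations act topologically
transitively: two basic open sets restrict finitely many constants each, a permutation makes these
finite sets disjoint, and a joint extension realizes both restrictions (`Theory.JEP.transitive`). An
invariant Borel function is then constant on a residual set, and this constant is an enforceable
value.

It is the only one, because two winning strategies can be played against each other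
(`Enforceable.exists_compiled_and`). For completeness, any finitely many sentences take their
generic values in one compiled structure, and an ultraproduct of such structures realizes all
generic values of finitary sentences at once. -/

theorem iSup_le_iSup_add {ι : Sort*} {f g : ι → I} {ε : ℝ} (hε : 0 ≤ ε)
    (h : ∀ i, (f i : ℝ) ≤ g i + ε) : ((⨆ i, f i : I) : ℝ) ≤ (⨆ i, g i : I) + ε := by
  -- The bound is a point of `I`, and so can serve as an upper bound there, only when it does not
  -- exceed `1`; otherwise the claim is trivial.
  rcases le_total 1 (((⨆ i, g i : I) : ℝ) + ε) with h1 | h1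
  · exact (⨆ i, f i : I).2.2.trans h1
  · have : (⨆ i, f i : I) ≤ ⟨(⨆ i, g i : I) + ε, add_nonneg (⨆ i, g i : I).2.1 hε, h1⟩ := by
      refine iSup_le fun i => ?_
      have h2 : (g i : ℝ) ≤ (⨆ i, g i : I) := le_iSup g i
      exact (h i).trans (by linarith : (g i : ℝ) + ε ≤ (⨆ i, g i : I) + ε)
    exact this

theorem iInf_le_iInf_add {ι : Sort*} {f g : ι → I} {ε : ℝ} (hε : 0 ≤ ε)
    (h : ∀ i, (f i : ℝ) ≤ g i + ε) : ((⨅ i, f i : I) : ℝ) ≤ (⨅ i, g i : I) + ε := by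
  rcases le_total (((⨅ i, f i : I) : ℝ) - ε) 0 with h1 | h1
  · linarith [(⨅ i, g i : I).2.1]
  · have : (⟨(⨅ i, f i : I) - ε, h1, by linarith [(⨅ i, f i : I).2.2]⟩ : I) ≤ ⨅ i, g i := by
      refine le_iInf fun i => ?_
      have h2 : ((⨅ i, f i : I) : ℝ) ≤ f i := iInf_le f i
      exact (by linarith [h i] : ((⨅ i, f i : I) : ℝ) - ε ≤ g i)
    have h3 : ((⨅ i, f i : I) : ℝ) - ε ≤ (⨅ i, g i : I) := this
    linarith

theorem dist_le_iff_le_add {x y : I} {ε : ℝ} :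
    dist x y ≤ ε ↔ (x : ℝ) ≤ y + ε ∧ (y : ℝ) ≤ x + ε := by
  rw [Subtype.dist_eq, Real.dist_eq, abs_le]
  constructor <;> rintro ⟨h1, h2⟩ <;> constructor <;> linarith

theorem dist_iSup_le {ι : Sort*} {f g : ι → I} {ε : ℝ} (hε : 0 ≤ ε)
    (h : ∀ i, dist (f i) (g i) ≤ ε) : dist (⨆ i, f i) (⨆ i, g i) ≤ ε :=
  dist_le_iff_le_add.2 ⟨iSup_le_iSup_add hε fun i => (dist_le_iff_le_add.1 (h i)).1,
    iSup_le_iSup_add hε fun i => (dist_le_iff_le_add.1 (h i)).2⟩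

theorem dist_iInf_le {ι : Sort*} {f g : ι → I} {ε : ℝ} (hε : 0 ≤ ε)
    (h : ∀ i, dist (f i) (g i) ≤ ε) : dist (⨅ i, f i) (⨅ i, g i) ≤ ε :=
  dist_le_iff_le_add.2 ⟨iInf_le_iInf_add hε fun i => (dist_le_iff_le_add.1 (h i)).1,
    iInf_le_iInf_add hε fun i => (dist_le_iff_le_add.1 (h i)).2⟩

/-- The condition `f x ≤ c` is closed in `x`. This reduces quantifiers to choice functions in
ultraproducts and to closed terms in compiled structures. -/
theorem iSup_comp_denseRange {X : Type*} [TopologicalSpace X] {κ : Type*} {e : κ → X}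
    (he : DenseRange e) {f : X → I} (hf : Continuous f) : ⨆ x, f x = ⨆ k, f (e k) := by
  refine le_antisymm (iSup_le fun x => ?_) (iSup_le fun k => le_iSup f (e k))
  exact he.induction_on (p := fun x => f x ≤ ⨆ k, f (e k)) x
    (isClosed_le hf continuous_const) fun k => le_iSup (fun k => f (e k)) k

theorem iInf_comp_denseRange {X : Type*} [TopologicalSpace X] {κ : Type*} {e : κ → X}
    (he : DenseRange e) {f : X → I} (hf : Continuous f) : ⨅ x, f x = ⨅ k, f (e k) := by
  refine le_antisymm (le_iInf fun k => iInf_le f (e k)) (le_iInf fun x => ?_)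
  exact he.induction_on (p := fun x => ⨅ k, f (e k) ≤ f x) x
    (isClosed_le continuous_const hf) fun k => iInf_le (fun k => f (e k)) k

/-! ### Uniform continuity of formulas -/

section Continuity

variable {L : Signature.{u}}

theorem Term.uniformContinuous_val (M : Struct L) {n : ℕ} (t : Term L n) :
    UniformContinuous fun a : Fin n → M.carrier => t.val M a := by
  induction t with
  | var i => exact Pi.uniformContinuous_proj (fun _ => M.carrier) i
  | app f ts ih => exact (M.func_unif f).uniformContinuous.comp (uniformContinuous_pi.2 ih)

theorem Struct.uniformContinuous_idist (M : Struct L) :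
    UniformContinuous fun x : M.carrier × M.carrier => M.idist x.1 x.2 :=
  uniformContinuous_dist.subtype_mk _

theorem Atomic.uniformContinuous_val (M : Struct L) {n : ℕ} (α : Atomic L n) :
    UniformContinuous fun a : Fin n → M.carrier => α.val M a := by
  cases α with
  | dist s t =>
    exact M.uniformContinuous_idist.comp
      ((s.uniformContinuous_val M).prodMk (t.uniformContinuous_val M))
  | pred R ts =>
    exact (M.pred_unif R).uniformContinuous.comp
      (uniformContinuous_pi.2 fun i => (ts i).uniformContinuous_val M)

theorem dist_snoc_le {X : Type*} [PseudoMetricSpace X] {n : ℕ} (a b : Fin n → X) (x : X) :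
    dist (Fin.snoc (α := fun _ : Fin (n + 1) => X) a x)
      (Fin.snoc (α := fun _ : Fin (n + 1) => X) b x) ≤ dist a b := by
  refine (dist_pi_le_iff dist_nonneg).2 fun i => ?_
  refine Fin.lastCases ?_ (fun j => ?_) i
  · simp
  · simpa using dist_le_pi_dist a b j

theorem continuous_snoc {X : Type*} [TopologicalSpace X] {n : ℕ} (a : Fin n → X) :
    Continuous fun x : X => Fin.snoc (α := fun _ : Fin (n + 1) => X) a x := by
  refine continuous_pi fun i => ?_
  refine Fin.lastCases ?_ (fun j => ?_) i
  · simpa using continuous_id'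
  · simpa using continuous_const

/-- Connectives are uniformly continuous because cubes are compact, and quantifiers cause no loss
because appending a common last coordinate does not increase distances. Only the countable suprema
and infima need the assumption of a common modulus. -/
theorem PreFormula.uniformContinuous_val (M : Struct L) {n : ℕ} (φ : PreFormula L n)
    (hφ : φ.IsInfFormula) : UniformContinuous fun a : Fin n → M.carrier => φ.val M a := by
  induction φ with
  | atomic α => simpa only [PreFormula.val] using α.uniformContinuous_val M
  | conn c φ ih =>
    simp only [PreFormula.val]
    exact (CompactSpace.uniformContinuous_of_continuous c.continuous).comp
      (uniformContinuous_pi.2 fun i => ih i (hφ i))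
  | sup φ ih =>
    simp only [PreFormula.val]
    rw [Metric.uniformContinuous_iff]
    intro ε hε
    obtain ⟨δ, hδ, h⟩ := Metric.uniformContinuous_iff.1 (ih hφ) (ε / 2) (half_pos hε)
    refine ⟨δ, hδ, fun {a b} hab => lt_of_le_of_lt ?_ (half_lt_self hε)⟩
    exact dist_iSup_le (half_pos hε).le fun x => (h ((dist_snoc_le a b x).trans_lt hab)).le
  | inf φ ih =>
    simp only [PreFormula.val]
    rw [Metric.uniformContinuous_iff]
    intro ε hε
    obtain ⟨δ, hδ, h⟩ := Metric.uniformContinuous_iff.1 (ih hφ) (ε / 2) (half_pos hε)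
    refine ⟨δ, hδ, fun {a b} hab => lt_of_le_of_lt ?_ (half_lt_self hε)⟩
    exact dist_iInf_le (half_pos hε).le fun x => (h ((dist_snoc_le a b x).trans_lt hab)).le
  | bigSup φ ih =>
    obtain ⟨-, δ, hδ⟩ := hφ
    simp only [PreFormula.val]
    have : δ.Respects fun a : Fin _ → M.carrier => ⨆ m, (φ m).val M a :=
      fun ε hε a b hab => dist_iSup_le hε.le fun m => hδ m M ε hε a b hab
    exact this.uniformContinuous
  | bigInf φ ih =>
    obtain ⟨-, δ, hδ⟩ := hφ
    simp only [PreFormula.val]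
    have : δ.Respects fun a : Fin _ → M.carrier => ⨅ m, (φ m).val M a :=
      fun ε hε a b hab => dist_iInf_le hε.le fun m => hδ m M ε hε a b hab
    exact this.uniformContinuous

theorem PreFormula.continuous_val_snoc (M : Struct L) {n : ℕ} (φ : PreFormula L (n + 1))
    (hφ : φ.IsInfFormula) (a : Fin n → M.carrier) :
    Continuous fun x => φ.val M (Fin.snoc (α := fun _ : Fin (n + 1) => M.carrier) a x) :=
  (φ.uniformContinuous_val M hφ).continuous.comp (continuous_snoc a)

theorem PreFormula.IsFinitary.isInfFormula {n : ℕ} {φ : PreFormula L n} (h : φ.IsFinitary) :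
    φ.IsInfFormula := by
  induction φ with
  | atomic α => trivial
  | conn c φ ih => exact fun i => ih i (h i)
  | sup φ ih => exact ih h
  | inf φ ih => exact ih h
  | bigSup φ ih => exact h.elim
  | bigInf φ ih => exact h.elim

end Continuity

/-! ### Ultraproducts -/

section Ultraproduct

variable {L : Signature.{u}} {ι : Type u} {𝒰 : Ultrafilter ι} {M : ι → Struct L}

theorem exists_tendsto_ultrafilter {X : Type*} [TopologicalSpace X] [CompactSpace X]
    (𝒰 : Ultrafilter ι) (f : ι → X) : ∃ x, Tendsto f 𝒰 (𝓝 x) :=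
  let ⟨x, _, hx⟩ := isCompact_univ.ultrafilter_le_nhds (𝒰.map f) (by simp)
  ⟨x, hx⟩

/-- The limit of a `[0,1]`-valued family along an ultrafilter. -/
noncomputable def ulim (𝒰 : Ultrafilter ι) (f : ι → I) : I :=
  (exists_tendsto_ultrafilter 𝒰 f).choose

theorem tendsto_ulim (𝒰 : Ultrafilter ι) (f : ι → I) : Tendsto f 𝒰 (𝓝 (ulim 𝒰 f)) :=
  (exists_tendsto_ultrafilter 𝒰 f).choose_spec

theorem tendsto_coe_ulim (𝒰 : Ultrafilter ι) (f : ι → I) :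
    Tendsto (fun i => (f i : ℝ)) 𝒰 (𝓝 (ulim 𝒰 f : ℝ)) :=
  (continuous_subtype_val.tendsto _).comp (tendsto_ulim 𝒰 f)

/-- The pseudometric on the product of a family of structures given by the limits of distances
along an ultrafilter. -/
noncomputable abbrev ultraPseudoMetric (𝒰 : Ultrafilter ι) (M : ι → Struct L) :
    PseudoMetricSpace (∀ i, (M i).carrier) where
  dist a b := (ulim 𝒰 fun i => (M i).idist (a i) (b i) : I)
  dist_self a := by
    refine tendsto_nhds_unique (tendsto_coe_ulim 𝒰 _) ?_
    simp [Struct.idist]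
  dist_comm a b := by simp [Struct.idist, dist_comm]
  dist_triangle a b c := by
    refine le_of_tendsto_of_tendsto' (tendsto_coe_ulim 𝒰 _)
      ((tendsto_coe_ulim 𝒰 _).add (tendsto_coe_ulim 𝒰 _)) fun i => ?_
    exact dist_triangle (a i) (b i) (c i)

/-- The maximum metric involves finitely many coordinates, so the strict inequality passes from the
limit to almost all factors. This is how the moduli of the factors carry over to the product. -/
theorem eventually_dist_lt_of_ultraPseudoMetric {n : ℕ} {a b : Fin n → ∀ i, (M i).carrier} {δ : ℝ}
    (hδ : 0 < δ) (h : letI := ultraPseudoMetric 𝒰 M; dist a b < δ) :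
    ∀ᶠ i in 𝒰, dist (fun j => a j i) (fun j => b j i) < δ := by
  let _ := ultraPseudoMetric 𝒰 M
  have h' : ∀ j, ∀ᶠ i in 𝒰, dist (a j i) (b j i) < δ := fun j =>
    (tendsto_coe_ulim 𝒰 fun i => (M i).idist (a j i) (b j i)).eventually_lt_const
      ((dist_pi_lt_iff hδ).1 h j)
  filter_upwards [eventually_all.2 h'] with i hi
  exact (dist_pi_lt_iff hδ).2 hi

/-- The product of a family of structures, as a prestructure whose metric and predicates are
limits along an ultrafilter. -/
noncomputable def ultraPrestructure (𝒰 : Ultrafilter ι) (M : ι → Struct L) : Prestructure L :=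
  letI := ultraPseudoMetric 𝒰 M
  { carrier := ∀ i, (M i).carrier
    nonempty := inferInstance
    dist_le_one := fun a b => (ulim 𝒰 fun i => (M i).idist (a i) (b i)).2.2
    func := fun f a i => (M i).func f fun j => a j i
    pred := fun R a => ulim 𝒰 fun i => (M i).pred R fun j => a j i
    func_unif := fun f ε hε a b hab => by
      refine le_of_tendsto (tendsto_coe_ulim 𝒰 _) ?_
      filter_upwards [eventually_dist_lt_of_ultraPseudoMetric ((L.funcMod f).pos ε hε) hab]
        with i hi
      exact (M i).func_unif f ε hε _ _ hi
    pred_unif := fun R ε hε a b hab => by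
      refine le_of_tendsto ((tendsto_ulim 𝒰 _).dist (tendsto_ulim 𝒰 _)) ?_
      filter_upwards [eventually_dist_lt_of_ultraPseudoMetric ((L.predMod R).pos ε hε) hab]
        with i hi
      exact (M i).pred_unif R ε hε _ _ hi }

/-- `U` is an ultraproduct of the structures `M i`: its metric and predicates are limits along `𝒰`
on the dense image of the product of the `M i`. -/
structure IsUltraproduct (𝒰 : Ultrafilter ι) (M : ι → Struct L) (U : Struct L)
    (π : (∀ i, (M i).carrier) → U.carrier) : Prop where
  denseRange : DenseRange π
  tendsto_idist : ∀ a b,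
    Tendsto (fun i => (M i).idist (a i) (b i)) 𝒰 (𝓝 (U.idist (π a) (π b)))
  map_func : ∀ {n} (f : L.Func n) (a : Fin n → ∀ i, (M i).carrier),
    U.func f (fun j => π (a j)) = π fun i => (M i).func f fun j => a j i
  tendsto_pred : ∀ {n} (R : L.Pred n) (a : Fin n → ∀ i, (M i).carrier),
    Tendsto (fun i => (M i).pred R fun j => a j i) 𝒰 (𝓝 (U.pred R fun j => π (a j)))

theorem exists_isUltraproduct (𝒰 : Ultrafilter ι) (M : ι → Struct L) :
    ∃ (U : Struct L) (π : (∀ i, (M i).carrier) → U.carrier), IsUltraproduct 𝒰 M U π := by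
  let A := ultraPrestructure 𝒰 M
  let _ : PseudoMetricSpace (∀ i, (M i).carrier) := ultraPseudoMetric 𝒰 M
  refine ⟨A.completion, UniformSpace.Completion.coe' (α := A.carrier), ?_, ?_, ?_, ?_⟩
  · exact UniformSpace.Completion.denseRange_coe (α := A.carrier)
  · intro a b
    convert tendsto_ulim 𝒰 fun i => (M i).idist (a i) (b i) using 2
    exact Subtype.ext (UniformSpace.Completion.dist_eq (α := A.carrier) a b)
  · intro n f a
    refine extendPow_coe (X := A.carrier) (δ := L.funcMod f)
      (f := fun a => ((A.func f a : A.carrier) : UniformSpace.Completion A.carrier)) ?_ a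
    intro ε hε x y hxy
    rw [UniformSpace.Completion.dist_eq]
    exact A.func_unif f ε hε x y hxy
  · intro n R a
    convert tendsto_ulim 𝒰 fun i => (M i).pred R fun j => a j i using 2
    exact extendPow_coe (X := A.carrier) (A.pred_unif R) a

variable {U : Struct L} {π : (∀ i, (M i).carrier) → U.carrier}

theorem IsUltraproduct.term_val (h : IsUltraproduct 𝒰 M U π) {n : ℕ} (t : Term L n)
    (a : Fin n → ∀ i, (M i).carrier) :
    t.val U (fun j => π (a j)) = π fun i => t.val (M i) fun j => a j i := by
  induction t with
  | var i => rfl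
  | app f ts ih =>
    simp only [Term.val, ih]
    exact h.map_func f fun k i => (ts k).val (M i) fun j => a j i

theorem IsUltraproduct.tendsto_atomic_val (h : IsUltraproduct 𝒰 M U π) {n : ℕ} (α : Atomic L n)
    (a : Fin n → ∀ i, (M i).carrier) :
    Tendsto (fun i => α.val (M i) fun j => a j i) 𝒰 (𝓝 (α.val U fun j => π (a j))) := by
  cases α with
  | dist s t =>
    simp only [Atomic.val, h.term_val]
    exact h.tendsto_idist _ _
  | pred R ts =>
    simp only [Atomic.val, h.term_val]
    exact h.tendsto_pred R fun k i => (ts k).val (M i) fun j => a j i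

/-- A limit of suprema over the factors of an ultraproduct is the supremum over all choice
functions of the limits. -/
theorem tendsto_iSup_of_ultrafilter {X : ι → Type*} [∀ i, Nonempty (X i)] {f : ∀ i, X i → I}
    {g : (∀ i, X i) → I} (h : ∀ b, Tendsto (fun i => f i (b i)) 𝒰 (𝓝 (g b))) :
    Tendsto (fun i => ⨆ x, f i x) 𝒰 (𝓝 (⨆ b, g b)) := by
  obtain ⟨s, hs⟩ := exists_tendsto_ultrafilter 𝒰 fun i => ⨆ x, f i x
  convert hs
  refine le_antisymm (iSup_le fun b => ?_) (le_of_forall_lt fun c hc => ?_)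
  · exact le_of_tendsto_of_tendsto' (h b) hs fun i => le_iSup (f i) (b i)
  · obtain ⟨c', hcc', hc's⟩ := exists_between hc
    -- Near-maximizers chosen in all factors at once form one choice function; in factors whose
    -- supremum does not exceed `c'` an arbitrary point is used.
    have hb : ∀ i, ∃ x, c' < ⨆ x, f i x → c' < f i x := fun i => by
      by_cases hi : c' < ⨆ x, f i x
      · obtain ⟨x, hx⟩ := lt_iSup_iff.1 hi
        exact ⟨x, fun _ => hx⟩
      · exact ⟨Classical.arbitrary _, fun h => (hi h).elim⟩
    choose b hb using hb
    have : c' ≤ g b := by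
      refine ge_of_tendsto (h b) ?_
      filter_upwards [hs.eventually_const_lt hc's] with i hi using (hb i hi).le
    exact hcc'.trans_le (this.trans (le_iSup g b))

theorem tendsto_iInf_of_ultrafilter {X : ι → Type*} [∀ i, Nonempty (X i)] {f : ∀ i, X i → I}
    {g : (∀ i, X i) → I} (h : ∀ b, Tendsto (fun i => f i (b i)) 𝒰 (𝓝 (g b))) :
    Tendsto (fun i => ⨅ x, f i x) 𝒰 (𝓝 (⨅ b, g b)) := by
  obtain ⟨s, hs⟩ := exists_tendsto_ultrafilter 𝒰 fun i => ⨅ x, f i x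
  convert hs
  refine le_antisymm (le_of_forall_gt fun c hc => ?_) (le_iInf fun b => ?_)
  · obtain ⟨c', hsc', hc'c⟩ := exists_between hc
    have hb : ∀ i, ∃ x, ⨅ x, f i x < c' → f i x < c' := fun i => by
      by_cases hi : ⨅ x, f i x < c'
      · obtain ⟨x, hx⟩ := iInf_lt_iff.1 hi
        exact ⟨x, fun _ => hx⟩
      · exact ⟨Classical.arbitrary _, fun h => (hi h).elim⟩
    choose b hb using hb
    have : g b ≤ c' := by
      refine le_of_tendsto (h b) ?_
      filter_upwards [hs.eventually_lt_const hsc'] with i hi using (hb i hi).le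
    exact ((iInf_le g b).trans this).trans_lt hc'c
  · exact le_of_tendsto_of_tendsto' hs (h b) fun i => iInf_le (f i) (b i)

/-- The theorem of Łoś on ultraproducts. -/
theorem IsUltraproduct.tendsto_val (h : IsUltraproduct 𝒰 M U π) {n : ℕ} (φ : PreFormula L n)
    (hφ : φ.IsFinitary) (a : Fin n → ∀ i, (M i).carrier) :
    Tendsto (fun i => φ.val (M i) fun j => a j i) 𝒰 (𝓝 (φ.val U fun j => π (a j))) := by
  have snoc_apply : ∀ {n : ℕ} (a : Fin n → ∀ i, (M i).carrier) (b : ∀ i, (M i).carrier) (i : ι),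
      (fun j => Fin.snoc (α := fun _ : Fin (n + 1) => ∀ i, (M i).carrier) a b j i) =
        Fin.snoc (α := fun _ : Fin (n + 1) => (M i).carrier) (fun j => a j i) (b i) :=
    fun a b i => Fin.comp_snoc (fun x : ∀ i, (M i).carrier => x i) a b
  have snoc_map : ∀ {n : ℕ} (a : Fin n → ∀ i, (M i).carrier) (b : ∀ i, (M i).carrier),
      (fun j => π (Fin.snoc (α := fun _ : Fin (n + 1) => ∀ i, (M i).carrier) a b j)) =
        Fin.snoc (α := fun _ : Fin (n + 1) => U.carrier) (fun j => π (a j)) (π b) :=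
    fun a b => Fin.comp_snoc π a b
  induction φ with
  | atomic α => exact h.tendsto_atomic_val α a
  | conn c φ ih =>
    simp only [PreFormula.val]
    exact (c.continuous.tendsto _).comp (tendsto_pi_nhds.2 fun k => ih k (hφ k) a)
  | sup φ ih =>
    simp only [PreFormula.val]
    -- Points of `U` outside the image of `π` do not affect the supremum, so it runs over choice
    -- functions.
    rw [iSup_comp_denseRange h.denseRange (φ.continuous_val_snoc U hφ.isInfFormula _)]
    refine tendsto_iSup_of_ultrafilter fun b => ?_
    simpa only [snoc_apply, snoc_map] using ih hφ (Fin.snoc a b)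
  | inf φ ih =>
    simp only [PreFormula.val]
    rw [iInf_comp_denseRange h.denseRange (φ.continuous_val_snoc U hφ.isInfFormula _)]
    refine tendsto_iInf_of_ultrafilter fun b => ?_
    simpa only [snoc_apply, snoc_map] using ih hφ (Fin.snoc a b)
  | bigSup φ ih => exact hφ.elim
  | bigInf φ ih => exact hφ.elim

theorem IsUltraproduct.tendsto_sval (h : IsUltraproduct 𝒰 M U π) (φ : Sentence L) :
    Tendsto (fun i => (M i).sval φ.1) 𝒰 (𝓝 (U.sval φ.1)) := by
  simp only [Struct.sval]
  convert h.tendsto_val φ.1 φ.2 Fin.elim0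

theorem IsUltraproduct.models (h : IsUltraproduct 𝒰 M U π) {T : Theory L}
    (hM : ∀ c ∈ T, ∀ᶠ i in 𝒰, (M i).sval c.1.1 = c.2) : U.Models T := fun c hc =>
  tendsto_nhds_unique (h.tendsto_sval c.1)
    (tendsto_const_nhds.congr' ((hM c hc).mono fun _ hi => hi.symm))

/-- Lets the theorem of Łoś be applied to the sentences of `T`, which are written in `L`, while
atomic sentences are evaluated in `L(C)`. -/
theorem IsUltraproduct.reduct {C : Type u} {M : ι → Struct (L.withConsts C)}
    {U : Struct (L.withConsts C)} {π : (∀ i, (M i).carrier) → U.carrier}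
    (h : IsUltraproduct 𝒰 M U π) :
    IsUltraproduct 𝒰 (fun i => (M i).reduct) U.reduct π where
  denseRange := h.denseRange
  tendsto_idist := h.tendsto_idist
  map_func f := h.map_func (.old f : FuncWith L C _)
  tendsto_pred {n} R := h.tendsto_pred (n := n) R

end Ultraproduct

/-! ### Countability of the language -/

section Countable

variable {L : Signature.{u}}

/-- The constructors of terms, as the nodes of a tree. -/
abbrev TermNode (L : Signature.{u}) (n : ℕ) : Type u := Fin n ⊕ Σ k, L.Func k

/-- The arity of a constructor of terms. -/
def TermNode.arity {n : ℕ} : TermNode L n → ℕ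
  | .inl _ => 0
  | .inr f => f.1

/-- The tree of a term. -/
def Term.toWType {n : ℕ} : Term L n → WType fun c : TermNode L n => Fin c.arity
  | .var i => ⟨.inl i, Fin.elim0⟩
  | .app (k := k) f ts => ⟨.inr ⟨k, f⟩, fun i => (ts i).toWType⟩

/-- W-types with countably many nodes of finite arity are countable, so this embedding yields the
countability of terms. -/
theorem Term.toWType_injective {n : ℕ} :
    Function.Injective (Term.toWType : Term L n → WType fun c : TermNode L n => Fin c.arity) := by
  intro s
  induction s with
  | var i =>
    intro t h
    cases t with
    | var j => injection h with h1 _; rw [Sum.inl.inj h1]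
    | app g us => injection h with h1 _; cases h1
  | app f ts ih =>
    intro t h
    cases t with
    | var j => injection h with h1 _; cases h1
    | app g us =>
      injection h with h1 h2
      cases h1
      congr 1
      funext i
      exact ih i (congrFun (eq_of_heq h2) i)

instance Term.countable [L.IsCountable] (n : ℕ) : Countable (Term L n) := by
  have : ∀ k, Countable (L.Func k) := Signature.IsCountable.func
  have := Encodable.ofCountable (TermNode L n)
  exact Term.toWType_injective.countable

instance Atomic.countable [L.IsCountable] (n : ℕ) : Countable (Atomic L n) := by
  have : ∀ k, Countable (L.Pred k) := Signature.IsCountable.pred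
  let e : (Term L n × Term L n) ⊕ (Σ k, L.Pred k × (Fin k → Term L n)) → Atomic L n
    | .inl x => .dist x.1 x.2
    | .inr x => .pred x.2.1 x.2.2
  refine Function.Surjective.countable (f := e) fun α => ?_
  cases α with
  | dist s t => exact ⟨.inl (s, t), rfl⟩
  | pred R ts => exact ⟨.inr ⟨_, R, ts⟩, rfl⟩

instance Signature.withConsts_isCountable [hL : L.IsCountable] (C : Type u) [Countable C] :
    (L.withConsts C).IsCountable where
  func n := by
    have := hL.func n
    let e : {n : ℕ} → FuncWith L C n → L.Func n ⊕ C := fun f => match f with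
      | .old f => .inl f
      | .const c => .inr c
    have he : Function.Injective (e : FuncWith L C n → L.Func n ⊕ C) := fun f g h => by
      cases f <;> cases g <;> simp_all [e]
    exact he.countable
  pred n := hL.pred n

end Countable

/-! ### Evaluation over the closed terms -/

section TermVal

variable {L : Signature.{u}} {C : Type u}

/-- The quantifier-free diagram of a structure. -/
def Struct.diagram (M : Struct L) : Atomic L 0 → I := fun α => α.val M Fin.elim0

/-- Substitution of closed `L(C)`-terms in an `L`-term. -/
def Term.inst {n : ℕ} (t : Fin n → Term (L.withConsts C) 0) : Term L n → Term (L.withConsts C) 0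
  | .var i => t i
  | .app f ts => .app (.old f : FuncWith L C _) fun i => (ts i).inst t

/-- Substitution of closed `L(C)`-terms in an atomic `L`-formula. -/
def Atomic.inst {n : ℕ} (t : Fin n → Term (L.withConsts C) 0) :
    Atomic L n → Atomic (L.withConsts C) 0
  | .dist s s' => .dist (s.inst t) (s'.inst t)
  | .pred (k := k) R ts => .pred (L := L.withConsts C) (k := k) R fun i => (ts i).inst t

/-- The value of an `L`-formula computed from a quantifier-free diagram `v`, with the quantifiers
ranging over the closed `L(C)`-terms. -/
noncomputable def PreFormula.termVal (v : Atomic (L.withConsts C) 0 → I) :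
    {n : ℕ} → PreFormula L n → (Fin n → Term (L.withConsts C) 0) → I
  | _, .atomic α, t => v (α.inst t)
  | _, .conn c φ, t => c (fun i => (φ i).termVal v t)
  | n, .sup φ, t => ⨆ x : Term (L.withConsts C) 0,
      φ.termVal v (Fin.snoc (α := fun _ : Fin (n + 1) => Term (L.withConsts C) 0) t x)
  | n, .inf φ, t => ⨅ x : Term (L.withConsts C) 0,
      φ.termVal v (Fin.snoc (α := fun _ : Fin (n + 1) => Term (L.withConsts C) 0) t x)
  | _, .bigSup φ, t => ⨆ m : ℕ, (φ m).termVal v t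
  | _, .bigInf φ, t => ⨅ m : ℕ, (φ m).termVal v t

theorem Term.val_inst (A : Struct (L.withConsts C)) {n : ℕ} (s : Term L n)
    (t : Fin n → Term (L.withConsts C) 0) :
    (s.inst t).val A Fin.elim0 = s.val A.reduct fun i => (t i).val A Fin.elim0 := by
  induction s with
  | var i => rfl
  | app f ts ih => simp only [Term.inst, Term.val, ih]; rfl

theorem Atomic.val_inst (A : Struct (L.withConsts C)) {n : ℕ} (α : Atomic L n)
    (t : Fin n → Term (L.withConsts C) 0) :
    (α.inst t).val A Fin.elim0 = α.val A.reduct fun i => (t i).val A Fin.elim0 := by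
  cases α with
  | dist s s' => simp only [Atomic.inst, Atomic.val, Term.val_inst]; rfl
  | pred R ts => simp only [Atomic.inst, Atomic.val, Term.val_inst]; rfl

/-- Values of formulas are continuous, so when the closed terms are dense the quantifiers may be
restricted to them. The value then depends on the diagram alone. -/
theorem PreFormula.val_reduct_eq_termVal (A : Struct (L.withConsts C))
    (hA : DenseRange fun s : Term (L.withConsts C) 0 => s.val A Fin.elim0) {n : ℕ}
    (φ : PreFormula L n) (hφ : φ.IsInfFormula) (t : Fin n → Term (L.withConsts C) 0) :
    φ.val A.reduct (fun i => (t i).val A Fin.elim0) = φ.termVal A.diagram t := by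
  have snoc_val : ∀ {n : ℕ} (t : Fin n → Term (L.withConsts C) 0) (x : Term (L.withConsts C) 0),
      (Fin.snoc (α := fun _ : Fin (n + 1) => A.reduct.carrier)
        (fun i => (t i).val A Fin.elim0) (x.val A Fin.elim0)) = fun i =>
        (Fin.snoc (α := fun _ : Fin (n + 1) => Term (L.withConsts C) 0) t x i).val A Fin.elim0 :=
    fun t x => (Fin.comp_snoc (fun s : Term (L.withConsts C) 0 => s.val A Fin.elim0) t x).symm
  have hA' : DenseRange (X := A.reduct.carrier)
    fun s : Term (L.withConsts C) 0 => s.val A Fin.elim0 := hA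
  induction φ with
  | atomic α => exact (α.val_inst A t).symm
  | conn c φ ih => simp only [PreFormula.val, PreFormula.termVal, ih _ (hφ _)]
  | sup φ ih =>
    simp only [PreFormula.val, PreFormula.termVal]
    refine (iSup_comp_denseRange hA' (φ.continuous_val_snoc A.reduct hφ _)).trans
      (iSup_congr fun x => ?_)
    exact (congrArg (φ.val A.reduct) (snoc_val t x)).trans (ih hφ _)
  | inf φ ih =>
    simp only [PreFormula.val, PreFormula.termVal]
    refine (iInf_comp_denseRange hA' (φ.continuous_val_snoc A.reduct hφ _)).trans
      (iInf_congr fun x => ?_)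
    exact (congrArg (φ.val A.reduct) (snoc_val t x)).trans (ih hφ _)
  | bigSup φ ih => simp only [PreFormula.val, PreFormula.termVal, ih _ (hφ.1 _)]
  | bigInf φ ih => simp only [PreFormula.val, PreFormula.termVal, ih _ (hφ.1 _)]

/-- There are countably many closed terms, so quantifiers are countable suprema and infima, just
like the infinitary connectives. -/
theorem PreFormula.measurable_termVal [L.IsCountable] [Countable C] {n : ℕ} (φ : PreFormula L n)
    (t : Fin n → Term (L.withConsts C) 0) :
    Measurable fun v : Atomic (L.withConsts C) 0 → I => φ.termVal v t := by
  induction φ with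
  | atomic α => exact measurable_pi_apply _
  | conn c φ ih =>
    simp only [PreFormula.termVal]
    exact c.continuous.measurable.comp (measurable_pi_iff.2 fun i => ih i t)
  | sup φ ih => exact Measurable.iSup fun x => ih (Fin.snoc t x)
  | inf φ ih => exact Measurable.iInf fun x => ih (Fin.snoc t x)
  | bigSup φ ih => exact Measurable.iSup fun m => ih m t
  | bigInf φ ih => exact Measurable.iInf fun m => ih m t

end TermVal

/-! ### Renaming the new constants -/

section Rename

variable {L : Signature.{u}} {C : Type u}

/-- Renaming of the new constants in a function symbol. -/
def FuncWith.rename (g : C → C) {n : ℕ} : FuncWith L C n → FuncWith L C n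
  | .old f => .old f
  | .const c => .const (g c)

/-- Renaming of the new constants in a term. -/
def Term.rename (g : C → C) {n : ℕ} : Term (L.withConsts C) n → Term (L.withConsts C) n
  | .var i => .var i
  | .app f ts => .app (FuncWith.rename (L := L) g f) fun i => (ts i).rename g

/-- Renaming of the new constants in an atomic formula. -/
def Atomic.rename (g : C → C) {n : ℕ} : Atomic (L.withConsts C) n → Atomic (L.withConsts C) n
  | .dist s t => .dist (s.rename g) (t.rename g)
  | .pred R ts => .pred R fun i => (ts i).rename g

theorem Term.rename_rename {g g' : C → C} (h : Function.LeftInverse g' g) {n : ℕ}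
    (t : Term (L.withConsts C) n) : (t.rename g).rename g' = t := by
  induction t with
  | var i => rfl
  | app f ts ih =>
    simp only [Term.rename, ih]
    congr 1
    cases f with
    | old f => rfl
    | const c => exact congrArg FuncWith.const (h c)

theorem Atomic.rename_rename {g g' : C → C} (h : Function.LeftInverse g' g) {n : ℕ}
    (α : Atomic (L.withConsts C) n) : (α.rename g).rename g' = α := by
  cases α <;> simp only [Atomic.rename, Term.rename_rename h]

/-- Renaming along a permutation, as a permutation of the closed terms. -/
def Term.renameEquiv (g : Equiv.Perm C) : Equiv.Perm (Term (L.withConsts C) 0) where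
  toFun := Term.rename g
  invFun := Term.rename g.symm
  left_inv := Term.rename_rename g.symm_apply_apply
  right_inv := Term.rename_rename g.apply_symm_apply

theorem Term.rename_inst (g : C → C) {n : ℕ} (s : Term L n)
    (t : Fin n → Term (L.withConsts C) 0) :
    (s.inst t).rename g = s.inst fun i => (t i).rename g := by
  induction s with
  | var i => rfl
  | app f ts ih => simp only [Term.inst, Term.rename, ih, FuncWith.rename]

theorem Atomic.rename_inst (g : C → C) {n : ℕ} (α : Atomic L n)
    (t : Fin n → Term (L.withConsts C) 0) :
    (α.inst t).rename g = α.inst fun i => (t i).rename g := by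
  cases α <;> simp only [Atomic.inst, Atomic.rename, Term.rename_inst]

/-- An `L`-formula contains no new constants, and a permutation of `C` permutes the closed terms
over which the quantifiers range. -/
theorem PreFormula.termVal_comp_rename (g : Equiv.Perm C) (v : Atomic (L.withConsts C) 0 → I)
    {n : ℕ} (φ : PreFormula L n) (t : Fin n → Term (L.withConsts C) 0) :
    φ.termVal (fun α => v (α.rename g)) t = φ.termVal v fun i => (t i).rename g := by
  have snoc_rename : ∀ {n : ℕ} (t : Fin n → Term (L.withConsts C) 0) (x : Term (L.withConsts C) 0),
      (fun i => (Fin.snoc (α := fun _ : Fin (n + 1) => Term (L.withConsts C) 0) t x i).rename g) =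
        Fin.snoc (α := fun _ : Fin (n + 1) => Term (L.withConsts C) 0)
          (fun i => (t i).rename g) (Term.renameEquiv g x) :=
    fun t x => Fin.comp_snoc (Term.rename g) t x
  induction φ with
  | atomic α => simp only [PreFormula.termVal, Atomic.rename_inst]
  | conn c φ ih => simp only [PreFormula.termVal, ih]
  | sup φ ih =>
    simp only [PreFormula.termVal, ih, snoc_rename]
    exact (Term.renameEquiv g).iSup_comp (g := fun x => φ.termVal v (Fin.snoc _ x))
  | inf φ ih =>
    simp only [PreFormula.termVal, ih, snoc_rename]
    exact (Term.renameEquiv g).iInf_comp (g := fun x => φ.termVal v (Fin.snoc _ x))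
  | bigSup φ ih => simp only [PreFormula.termVal, ih]
  | bigInf φ ih => simp only [PreFormula.termVal, ih]

/-- The structure obtained by interpreting each new constant `c` as `g c`. -/
def Struct.renameConsts (M : Struct (L.withConsts C)) (g : C → C) : Struct (L.withConsts C) where
  carrier := M.carrier
  dist_le_one := M.dist_le_one
  func f := M.func (FuncWith.rename (L := L) g f)
  pred := M.pred
  func_unif f := by
    cases f with
    | old f => exact M.func_unif (.old f : FuncWith L C _)
    | const c => exact M.func_unif (.const (g c) : FuncWith L C 0)
  pred_unif := M.pred_unif

theorem Term.val_renameConsts (M : Struct (L.withConsts C)) (g : C → C)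
    (t : Term (L.withConsts C) 0) :
    t.val (M.renameConsts g) Fin.elim0 = (t.rename g).val M Fin.elim0 := by
  induction t with
  | var i => exact i.elim0
  | app f ts ih => simp only [Term.rename, Term.val, ih]; rfl

theorem Struct.diagram_renameConsts (M : Struct (L.withConsts C)) (g : C → C) :
    (M.renameConsts g).diagram = fun α => M.diagram (α.rename g) := by
  funext α
  cases α <;> simp only [Struct.diagram, Atomic.rename, Atomic.val, Term.val_renameConsts] <;> rfl

end Rename

/-! ### The compiled structure -/

section Compiled

open UniformSpace (Completion)

variable {L : Signature.{u}} {C : Type u} [Nonempty C] {T : Theory L} {p : OpenSet L C}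

/-- The prestructure is the algebra of closed terms, so every term evaluates to its own image.
Density of the closed terms and the identification of the diagram both rest on this. -/
theorem Definitive.term_val_compiled (h : Definitive T p) (t : Term (L.withConsts C) 0) :
    t.val h.compiled Fin.elim0 = Completion.coe' (α := h.prestructure.carrier) t := by
  induction t with
  | var i => exact i.elim0
  | app f ts ih =>
    simp only [Term.val, ih]
    refine extendPow_coe (X := h.prestructure.carrier) (δ := (L.withConsts C).funcMod f)
      (f := fun a => ((h.prestructure.func f a : h.prestructure.carrier) :
        Completion h.prestructure.carrier)) ?_ ts
    intro ε hε x y hxy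
    rw [Completion.dist_eq]
    exact h.prestructure.func_unif f ε hε x y hxy

theorem Definitive.diagram_compiled (h : Definitive T p) : h.compiled.diagram = h.value := by
  funext α
  cases α with
  | dist s t =>
    simp only [Struct.diagram, Atomic.val, h.term_val_compiled]
    exact Subtype.ext (Completion.dist_eq (α := h.prestructure.carrier) s t)
  | pred R ts =>
    simp only [Struct.diagram, Atomic.val, h.term_val_compiled]
    exact extendPow_coe (X := h.prestructure.carrier) (h.prestructure.pred_unif R) ts

theorem Definitive.denseRange_val_compiled (h : Definitive T p) :
    DenseRange fun s : Term (L.withConsts C) 0 => s.val h.compiled Fin.elim0 := by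
  simp only [h.term_val_compiled]
  exact Completion.denseRange_coe (α := h.prestructure.carrier)

theorem Definitive.sval_compiled (h : Definitive T p) (φ : InfSentence L) :
    h.compiled.reduct.sval φ.1 = φ.1.termVal h.value Fin.elim0 := by
  rw [← h.diagram_compiled,
    ← φ.1.val_reduct_eq_termVal _ h.denseRange_val_compiled φ.2, Struct.sval]
  congr 1
  funext i
  exact i.elim0

end Compiled

/-! ### A topological zero-one law -/

section ZeroOne

variable {X ι : Type*} [TopologicalSpace X] [BaireSpace X] {h : ι → X ≃ₜ X}

/-- Modulo a meagre set, `s` is an open set `U`, which inherits the invariance of `s` generically.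
If `U` is nonempty, transitivity carries a part of any open set `V` into `U`, so `U` meets `V` and
is dense. -/
theorem BaireMeasurableSet.mem_residual_or_compl_of_transitive
    (ht : ∀ U V : Set X, IsOpen U → IsOpen V → U.Nonempty → V.Nonempty →
      ∃ i, (V ∩ h i ⁻¹' U).Nonempty) {s : Set X} (hs : BaireMeasurableSet s)
    (hinv : ∀ i, h i ⁻¹' s = s) : s ∈ residual X ∨ sᶜ ∈ residual X := by
  obtain ⟨U, hU, hsU⟩ := hs.residualEq_isOpen
  rcases U.eq_empty_or_nonempty with rfl | hne
  · right
    filter_upwards [hsU.mem_iff] with x hx using fun hxs => hx.1 hxs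
  · left
    suffices hd : Dense U by
      filter_upwards [hsU.mem_iff, residual_of_dense_open hU hd] with x hx hxU using hx.2 hxU
    rw [dense_iff_inter_open]
    intro V hV hVne
    obtain ⟨i, hi⟩ := ht U V hU hV hne hVne
    -- Preimages of residual sets under a homeomorphism are residual.
    have hpre : ∀ᶠ x in residual X, (h i x ∈ s ↔ h i x ∈ U) :=
      (tendsto_residual_of_isOpenMap (h i).continuous (h i).isOpenMap).eventually hsU.mem_iff
    have hev : ∀ᶠ x in residual X, (h i x ∈ U ↔ x ∈ U) := by
      filter_upwards [hpre, hsU.mem_iff] with x h1 h2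
      have h3 : h i x ∈ s ↔ x ∈ s := Set.ext_iff.1 (hinv i) x
      rw [← h1, h3, h2]
    -- Here the Baire property is used: the nonempty open set of points of `V` sent into `U`
    -- contains a generic point.
    obtain ⟨x, ⟨hxV, hxU⟩, hx⟩ := (dense_of_mem_residual hev).inter_open_nonempty _
      (hV.inter (hU.preimage (h i).continuous)) hi
    exact ⟨x, hxV, hx.1 hxU⟩

/-- Every Borel subset of `I` has a preimage that is residual or has residual complement. Countably
many Borel sets separate the points of `I`, so the generic value is pinned down. -/
theorem eventually_residual_eq_const_of_transitive
    (ht : ∀ U V : Set X, IsOpen U → IsOpen V → U.Nonempty → V.Nonempty →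
      ∃ i, (V ∩ h i ⁻¹' U).Nonempty) [MeasurableSpace X] [BorelSpace X] {f : X → I}
    (hf : Measurable f) (hinv : ∀ i x, f (h i x) = f x) :
    ∃ r, ∀ᶠ x in residual X, f x = r := by
  refine exists_eventuallyEq_const_of_forall_separating MeasurableSet fun B hB => ?_
  refine BaireMeasurableSet.mem_residual_or_compl_of_transitive ht (s := f ⁻¹' B)
    (hf hB).baireMeasurableSet fun i => ?_
  ext x
  simp [hinv]

end ZeroOne

/-! ### The space of diagrams -/

section Diagrams

variable {L : Signature.{u}} {C : Type u} {T : Theory L}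

/-- The quantifier-free diagrams of the `L(C)`-structures that are models of `T`. -/
def diagrams (T : Theory L) (C : Type u) : Set (Atomic (L.withConsts C) 0 → I) :=
  {v | ∃ M : Struct (L.withConsts C), M.reduct.Models T ∧ M.diagram = v}

/-- A limit of diagrams along an ultrafilter is the diagram of an ultraproduct of structures
realizing them, and by Łoś this ultraproduct models `T`. The diagrams themselves serve as the index
set. -/
theorem isClosed_diagrams (T : Theory L) (C : Type u) : IsClosed (diagrams T C) := by
  rw [isClosed_iff_ultrafilter]
  intro x 𝒰 hx h𝒰
  obtain ⟨v₀, M₀, -, -⟩ := 𝒰.nonempty_of_mem h𝒰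
  have hM : ∀ v, ∃ M : Struct (L.withConsts C),
      v ∈ diagrams T C → M.reduct.Models T ∧ M.diagram = v := fun v => by
    by_cases hv : v ∈ diagrams T C
    · obtain ⟨M, hM⟩ := hv
      exact ⟨M, fun _ => hM⟩
    -- Indices that are not diagrams form a set outside the ultrafilter, so an arbitrary structure
    -- may be placed there.
    · exact ⟨M₀, fun h => (hv h).elim⟩
  choose M hM using hM
  obtain ⟨U, π, hU⟩ := exists_isUltraproduct 𝒰 M
  refine ⟨U, hU.reduct.models fun c hc => ?_, funext fun α => ?_⟩
  · filter_upwards [h𝒰] with v hv using (hM v hv).1 c hc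
  · have h1 : Tendsto (fun v => (M v).diagram α) 𝒰 (𝓝 (U.diagram α)) := by
      simp only [Struct.diagram]
      convert hU.tendsto_atomic_val α Fin.elim0
    have h2 : Tendsto (fun v : Atomic (L.withConsts C) 0 → I => v α) 𝒰 (𝓝 (x α)) :=
      ((continuous_apply α).tendsto x).mono_left hx
    refine tendsto_nhds_unique h1 (h2.congr' ?_)
    filter_upwards [h𝒰] with v hv
    rw [(hM v hv).2]

instance compactSpace_diagrams (T : Theory L) (C : Type u) : CompactSpace (diagrams T C) :=
  isCompact_iff_compactSpace.1 (isClosed_diagrams T C).isCompact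

theorem rename_mem_diagrams (g : C → C) {v : Atomic (L.withConsts C) 0 → I}
    (hv : v ∈ diagrams T C) : (fun α => v (α.rename g)) ∈ diagrams T C := by
  obtain ⟨M, hM, rfl⟩ := hv
  exact ⟨M.renameConsts g, hM, M.diagram_renameConsts g⟩

/-- The homeomorphism of the space of diagrams given by a permutation of the new constants. -/
def renameDiagram (T : Theory L) (g : Equiv.Perm C) : diagrams T C ≃ₜ diagrams T C where
  toFun v := ⟨fun α => v.1 (α.rename g), rename_mem_diagrams g v.2⟩
  invFun v := ⟨fun α => v.1 (α.rename g.symm), rename_mem_diagrams g.symm v.2⟩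
  left_inv v := Subtype.ext <| funext fun α =>
    congrArg v.1 (Atomic.rename_rename g.apply_symm_apply α)
  right_inv v := Subtype.ext <| funext fun α =>
    congrArg v.1 (Atomic.rename_rename g.symm_apply_apply α)
  continuous_toFun := by
    refine Continuous.subtype_mk (continuous_pi fun α => ?_) _
    exact (continuous_apply _).comp continuous_subtype_val
  continuous_invFun := by
    refine Continuous.subtype_mk (continuous_pi fun α => ?_) _
    exact (continuous_apply _).comp continuous_subtype_val

/-- The interpretation of a new constant. -/
def Struct.const (M : Struct (L.withConsts C)) (c : C) : M.carrier :=
  M.func (.const c : FuncWith L C 0) Fin.elim0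

/-- The expansion of an `L`-structure by interpretations of the new constants. -/
def Struct.expand (N : Struct L) (e : C → N.carrier) : Struct (L.withConsts C) where
  carrier := N.carrier
  dist_le_one := N.dist_le_one
  func f a := match f with
    | .old f => N.func f a
    | .const c => e c
  pred {n} R := N.pred (n := n) R
  func_unif f := by
    cases f with
    | old f => exact N.func_unif f
    | const c => exact fun ε hε x y _ => (dist_self (e c)).trans_le hε.le
  pred_unif {n} R := N.pred_unif (n := n) R

/-- The set `A` collects the new constants occurring in `t`. The embedding is one of `L`-reducts, so
agreement on these constants has to be required separately. -/
theorem Term.exists_finset_consts (t : Term (L.withConsts C) 0) :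
    ∃ A : Finset C, ∀ (M N : Struct (L.withConsts C)) (f : Embedding M.reduct N.reduct),
      (∀ c ∈ A, f.toFun (M.const c) = N.const c) →
        f.toFun (t.val M Fin.elim0) = t.val N Fin.elim0 := by
  classical
  induction t with
  | var i => exact i.elim0
  | app s ts ih =>
    choose A hA using ih
    cases s with
    | old s =>
      refine ⟨Finset.univ.biUnion A, fun M N f hf => ?_⟩
      have h : ∀ i, f.toFun ((ts i).val M Fin.elim0) = (ts i).val N Fin.elim0 := fun i =>
        hA i M N f fun c hc => hf c (Finset.mem_biUnion.2 ⟨i, Finset.mem_univ i, hc⟩)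
      refine (f.map_func s fun i => (ts i).val M Fin.elim0).trans ?_
      simp only [h]
      rfl
    | const c =>
      refine ⟨{c}, fun M N f hf => ?_⟩
      have h : ∀ M : Struct (L.withConsts C),
          Term.val M Fin.elim0 (.app (.const c : FuncWith L C 0) ts) = M.const c := fun M =>
        congrArg (M.func (.const c : FuncWith L C 0)) (Subsingleton.elim _ _)
      exact (congrArg f.toFun (h M)).trans ((hf c (Finset.mem_singleton_self c)).trans (h N).symm)

theorem Atomic.exists_finset_consts (α : Atomic (L.withConsts C) 0) :
    ∃ A : Finset C, ∀ (M N : Struct (L.withConsts C)) (f : Embedding M.reduct N.reduct),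
      (∀ c ∈ A, f.toFun (M.const c) = N.const c) → M.diagram α = N.diagram α := by
  classical
  cases α with
  | dist s t =>
    obtain ⟨A, hA⟩ := s.exists_finset_consts
    obtain ⟨B, hB⟩ := t.exists_finset_consts
    refine ⟨A ∪ B, fun M N f hf => Subtype.ext ?_⟩
    change Dist.dist (s.val M Fin.elim0) (t.val M Fin.elim0) =
      Dist.dist (s.val N Fin.elim0) (t.val N Fin.elim0)
    rw [← hA M N f fun c hc => hf c (Finset.mem_union_left _ hc),
      ← hB M N f fun c hc => hf c (Finset.mem_union_right _ hc)]
    exact (f.isometry.dist_eq _ _).symm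
  | pred R ts =>
    choose A hA using fun i => (ts i).exists_finset_consts
    refine ⟨Finset.univ.biUnion A, fun M N f hf => ?_⟩
    have h : ∀ i, f.toFun ((ts i).val M Fin.elim0) = (ts i).val N Fin.elim0 := fun i =>
      hA i M N f fun c hc => hf c (Finset.mem_biUnion.2 ⟨i, Finset.mem_univ i, hc⟩)
    refine (f.map_pred R fun i => (ts i).val M Fin.elim0).symm.trans ?_
    simp only [h]
    rfl

/-- A neighbourhood of a diagram contains every diagram that agrees with it on suitable finitely
many atomic sentences. -/
theorem exists_finite_forall_eq_mem {U : Set (diagrams T C)} (hU : IsOpen U) {v : diagrams T C}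
    (hv : v ∈ U) : ∃ F : Set (Atomic (L.withConsts C) 0), F.Finite ∧
      ∀ w : diagrams T C, (∀ α ∈ F, w.1 α = v.1 α) → w ∈ U := by
  obtain ⟨O, hO, rfl⟩ := isOpen_induced_iff.1 hU
  have hmem : O ∈ Filter.pi fun α => 𝓝 (v.1 α) := nhds_pi (a := v.1) ▸ hO.mem_nhds hv
  obtain ⟨F, hF, t, ht, hsub⟩ := Filter.mem_pi.1 hmem
  exact ⟨F, hF, fun w hw => hsub fun α hα => hw α hα ▸ mem_of_mem_nhds (ht α)⟩

/-- A neighbourhood of the diagram of `M` contains the diagram of every model of `T` that extends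
`M` with the same interpretation of suitable finitely many new constants. -/
theorem exists_finset_forall_embedding_mem {U : Set (diagrams T C)} (hU : IsOpen U)
    {M : Struct (L.withConsts C)} (hM : M.reduct.Models T) (hv : ⟨M.diagram, M, hM, rfl⟩ ∈ U) :
    ∃ A : Finset C, ∀ (N : Struct (L.withConsts C)) (hN : N.reduct.Models T)
      (f : Embedding M.reduct N.reduct), (∀ c ∈ A, f.toFun (M.const c) = N.const c) →
        ⟨N.diagram, N, hN, rfl⟩ ∈ U := by
  classical
  obtain ⟨F, hF, h⟩ := exists_finite_forall_eq_mem hU hv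
  choose A hA using fun α : Atomic (L.withConsts C) 0 => α.exists_finset_consts
  refine ⟨hF.toFinset.biUnion A, fun N hN f hf => h _ fun α hα => ?_⟩
  exact (hA α M N f fun c hc => hf c (Finset.mem_biUnion.2 ⟨α, hF.mem_toFinset.2 hα, hc⟩)).symm

theorem exists_perm_image_disjoint [Countable C] [Infinite C] (A B : Finset C) :
    ∃ g : Equiv.Perm C, ∀ a ∈ A, g a ∉ B := by
  obtain ⟨e⟩ : Nonempty (C ≃ ℤ) := inferInstance
  obtain ⟨m, hm⟩ := (B.image e).bddAbove
  obtain ⟨l, hl⟩ := (A.image e).bddBelow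
  -- With `C` identified with `ℤ`, the translation by `m - l + 1` moves the lower bound `l` of `A`
  -- to `m + 1`, beyond the upper bound `m` of `B`.
  refine ⟨(e.trans (Equiv.addRight (m - l + 1))).trans e.symm, fun a ha hb => ?_⟩
  have h1 := hl (Finset.mem_coe.2 (Finset.mem_image_of_mem e ha))
  have h2 := hm (Finset.mem_coe.2 (Finset.mem_image_of_mem e hb))
  simp at h2
  omega

/-- Under the joint embedding property the permutations of the new constants act on the space of
diagrams topologically transitively. -/
theorem Theory.JEP.transitive [Countable C] [Infinite C] (hJEP : T.JEP) (U V : Set (diagrams T C))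
    (hU : IsOpen U) (hV : IsOpen V) (hUne : U.Nonempty) (hVne : V.Nonempty) :
    ∃ g : Equiv.Perm C, (V ∩ renameDiagram T g ⁻¹' U).Nonempty := by
  classical
  obtain ⟨⟨_, M, hM, rfl⟩, hMU⟩ := hUne
  obtain ⟨⟨_, N, hN, rfl⟩, hNV⟩ := hVne
  obtain ⟨A, hA⟩ := exists_finset_forall_embedding_mem hU hM hMU
  obtain ⟨B, hB⟩ := exists_finset_forall_embedding_mem hV hN hNV
  obtain ⟨g, hg⟩ := exists_perm_image_disjoint A B
  obtain ⟨K, hK, ⟨i⟩, ⟨j⟩⟩ := hJEP M.reduct N.reduct hM hN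
  -- Constants in `B` copy `N`, which puts the diagram of `K'` in `V`. All others copy `M` shifted
  -- by `g`: for `a ∈ A` the constant `g a` lies outside `B` and is interpreted as in `M` at `a`, so
  -- renaming by `g` gives a diagram in `U`.
  let K' : Struct (L.withConsts C) := K.expand fun c =>
    if c ∈ B then j.toFun (N.const c) else i.toFun (M.const (g.symm c))
  refine ⟨g, ⟨K'.diagram, K', hK, rfl⟩, hB K' hK j fun c hc => ?_, ?_⟩
  · exact (if_pos hc).symm
  · have hmem := hA (K'.renameConsts g) hK i fun c hc => ?_
    · change renameDiagram T g ⟨K'.diagram, K', hK, rfl⟩ ∈ U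
      convert hmem using 1
      exact Subtype.ext (K'.diagram_renameConsts g).symm
    · refine Eq.trans ?_ (if_neg (hg c hc)).symm
      rw [Equiv.symm_apply_apply]

/-- Under the joint embedding property every sentence has the same value in the structures given by
generic diagrams. -/
theorem Theory.JEP.exists_eventually_termVal_eq [L.IsCountable] [Countable C] [Infinite C]
    (hJEP : T.JEP) (φ : PreFormula L 0) :
    ∃ r, ∀ᶠ v : diagrams T C in residual _, φ.termVal v.1 Fin.elim0 = r := by
  refine eventually_residual_eq_const_of_transitive (h := renameDiagram T) hJEP.transitive
    (f := fun v : diagrams T C => φ.termVal v.1 Fin.elim0)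
    ((φ.measurable_termVal Fin.elim0).comp measurable_subtype_coe) fun g v => ?_
  refine (φ.termVal_comp_rename g v.1 Fin.elim0).trans ?_
  congr 1
  funext i
  exact i.elim0

end Diagrams

/-! ### Conditions as open sets of diagrams -/

section Conditions

variable {L : Signature.{u}} {C : Type u} {T : Theory L}

/-- The value of a restricted quantifier-free sentence computed from a diagram. -/
noncomputable def RSentence.eval (v : Atomic L 0 → I) : RSentence L → ℝ
  | .atomic α => v α
  | .half φ => φ.eval v / 2
  | .neg φ => 1 - φ.eval v
  | .dotplus φ ψ => min (φ.eval v + ψ.eval v) 1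

theorem RSentence.eval_diagram (M : Struct L) (φ : RSentence L) : φ.eval M.diagram = φ.val M := by
  induction φ with
  | atomic α => rfl
  | half φ ih => simp only [RSentence.eval, RSentence.val, ih]
  | neg φ ih => simp only [RSentence.eval, RSentence.val, ih]
  | dotplus φ ψ ih ih' => simp only [RSentence.eval, RSentence.val, ih, ih']

theorem RSentence.continuous_eval (φ : RSentence L) :
    Continuous fun v : Atomic L 0 → I => φ.eval v := by
  induction φ with
  | atomic α => exact continuous_subtype_val.comp (continuous_apply α)
  | half φ ih => exact ih.div_const 2
  | neg φ ih => exact continuous_const.sub ih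
  | dotplus φ ψ ih ih' => exact (ih.add ih').min continuous_const

/-- The diagrams of the models of `T` that satisfy all `φ < r` in `p`. -/
def openDiagrams (T : Theory L) (p : OpenSet L C) : Set (diagrams T C) :=
  {v | ∀ e ∈ p, e.1.eval v.1 < e.2}

/-- The diagrams of the models of `T` that satisfy `φ ≤ r` for all `φ < r` in `p`. -/
def closedDiagrams (T : Theory L) (p : OpenSet L C) : Set (diagrams T C) :=
  {v | ∀ e ∈ p, e.1.eval v.1 ≤ e.2}

theorem openDiagrams_subset_closedDiagrams (p : OpenSet L C) :
    openDiagrams T p ⊆ closedDiagrams T p := fun _ hv e he => (hv e he).le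

theorem openDiagrams_anti {p q : OpenSet L C} (h : p ⊆ q) :
    openDiagrams T q ⊆ openDiagrams T p := fun _ hv e he => hv e (h he)

theorem closedDiagrams_anti {p q : OpenSet L C} (h : p ⊆ q) :
    closedDiagrams T q ⊆ closedDiagrams T p := fun _ hv e he => hv e (h he)

theorem isOpen_openDiagrams {p : OpenSet L C} (hp : p.Finite) : IsOpen (openDiagrams T p) := by
  have : openDiagrams T p = ⋂ e ∈ p, {v | e.1.eval v.1 < e.2} := by
    ext v; simp [openDiagrams]
  rw [this]
  exact hp.isOpen_biInter fun e _ =>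
    isOpen_lt (e.1.continuous_eval.comp continuous_subtype_val) continuous_const

theorem isClosed_closedDiagrams (p : OpenSet L C) : IsClosed (closedDiagrams T p) := by
  have : closedDiagrams T p = ⋂ e ∈ p, {v | e.1.eval v.1 ≤ e.2} := by
    ext v; simp [closedDiagrams]
  rw [this]
  exact isClosed_biInter fun e _ =>
    isClosed_le (e.1.continuous_eval.comp continuous_subtype_val) continuous_const

theorem ModelsWith.mem_openDiagrams {p : OpenSet L C} {M : Struct (L.withConsts C)}
    (hM : ModelsWith T p M) : ⟨M.diagram, M, hM.1, rfl⟩ ∈ openDiagrams T p := fun e he => by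
  rw [RSentence.eval_diagram]
  exact hM.2 e he

theorem exists_modelsWith_of_mem_openDiagrams {p : OpenSet L C} {v : diagrams T C}
    (hv : v ∈ openDiagrams T p) : ∃ M, ModelsWith T p M ∧ M.diagram = v.1 := by
  obtain ⟨_, M, hM, rfl⟩ := v
  exact ⟨M, ⟨hM, fun e he => e.1.eval_diagram M ▸ hv e he⟩, rfl⟩

theorem Condition.openDiagrams_nonempty (p : Condition T C) : (openDiagrams T p.expr).Nonempty :=
  let ⟨_, hM⟩ := p.sat
  ⟨_, hM.mem_openDiagrams⟩

/-- Atomic sentences and their negations bound finitely many coordinates from above and below, which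
already gives a neighbourhood basis. The closed version is what the compactness argument in the game
needs. -/
theorem exists_finite_closedDiagrams_subset {O : Set (diagrams T C)} (hO : IsOpen O)
    {v : diagrams T C} (hv : v ∈ O) :
    ∃ q : OpenSet L C, q.Finite ∧ v ∈ openDiagrams T q ∧ closedDiagrams T q ⊆ O := by
  obtain ⟨O', hO', rfl⟩ := isOpen_induced_iff.1 hO
  have hmem : O' ∈ Filter.pi fun α => 𝓝 (v.1 α) := nhds_pi (a := v.1) ▸ hO'.mem_nhds hv
  obtain ⟨⟨F, ε⟩, ⟨hF, hε⟩, hsub⟩ :=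
    (hasBasis_pi fun α => Metric.nhds_basis_closedBall (x := v.1 α)).mem_iff.1 hmem
  refine ⟨(fun α => (.atomic α, v.1 α + ε α)) '' F ∪
    (fun α => (.neg (.atomic α), 1 - v.1 α + ε α)) '' F, (hF.image _).union (hF.image _), ?_, ?_⟩
  · rintro e (⟨α, hα, rfl⟩ | ⟨α, hα, rfl⟩) <;> simpa [RSentence.eval] using hε α hα
  · intro w hw
    refine hsub fun α hα => ?_
    have h1 : (w.1 α : ℝ) ≤ v.1 α + ε α := hw _ (.inl ⟨α, hα, rfl⟩)
    have h2 : 1 - (w.1 α : ℝ) ≤ 1 - v.1 α + ε α := hw _ (.inr ⟨α, hα, rfl⟩)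
    exact dist_le_iff_le_add.2 ⟨h1, by linarith⟩

/-- A condition can be extended so that the corresponding closed set of diagrams is contained in a
given dense open set and in a member of a given open cover. -/
theorem Condition.exists_extension (p : Condition T C) {D : Set (diagrams T C)} (hD : IsOpen D)
    (hDd : Dense D) {O : diagrams T C → Set (diagrams T C)} (hO : ∀ v, IsOpen (O v))
    (hOv : ∀ v, v ∈ O v) :
    ∃ q : Condition T C, p.expr ⊆ q.expr ∧ closedDiagrams T q.expr ⊆ openDiagrams T p.expr ∧
      closedDiagrams T q.expr ⊆ D ∧ ∃ v, closedDiagrams T q.expr ⊆ O v := by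
  obtain ⟨v, hvp, hvD⟩ := hDd.inter_open_nonempty _ (isOpen_openDiagrams p.finite)
    p.openDiagrams_nonempty
  obtain ⟨q, hq, hvq, hsub⟩ := exists_finite_closedDiagrams_subset
    (((isOpen_openDiagrams p.finite).inter hD).inter (hO v)) ⟨⟨hvp, hvD⟩, hOv v⟩
  have hv : v ∈ openDiagrams T (p.expr ∪ q) := fun e he => he.elim (hvp e) (hvq e)
  obtain ⟨M, hM, -⟩ := exists_modelsWith_of_mem_openDiagrams hv
  have hsub' := (closedDiagrams_anti (T := T) (Set.subset_union_right (s := p.expr) (t := q))).trans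
    hsub
  exact ⟨⟨p.expr ∪ q, p.finite.union hq, M, hM⟩, Set.subset_union_left,
    fun w hw => (hsub' hw).1.1, fun w hw => (hsub' hw).1.2, v, fun w hw => (hsub' hw).2⟩

/-- All models of `T ∪ p` have the diagram `v`, which gives the entailed values; that at least one
model exists makes them unique. -/
theorem exists_definitive_of_openDiagrams_eq_singleton {p : OpenSet L C} {v : diagrams T C}
    (h : openDiagrams T p = {v}) : ∃ hp : Definitive T p, hp.value = v.1 := by
  have hv : v ∈ openDiagrams T p := h ▸ rfl
  obtain ⟨M, hM, hMv⟩ := exists_modelsWith_of_mem_openDiagrams hv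
  have hp : Definitive T p := fun α => by
    refine ⟨v.1 α, fun N hN => ?_, fun r hr => ?_⟩
    · have hN' : _ = v := h ▸ hN.mem_openDiagrams
      exact congrFun (congrArg Subtype.val hN') α
    · rw [← hr M hM, ← hMv]
      rfl
  refine ⟨hp, funext fun α => ?_⟩
  rw [hp.value_eq α hM, ← hMv]
  rfl

theorem Definitive.value_mem_diagrams [Nonempty C] {p : OpenSet L C} (h : Definitive T p) :
    h.value ∈ diagrams T C :=
  let ⟨M, hM⟩ := h.exists_model
  ⟨M, hM.1, funext fun α => (h.value_eq α hM).symm⟩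

end Conditions

/-! ### The game -/

section Strategies

variable {L : Signature.{u}} {C : Type u} {T : Theory L}

/-- A property of the generic diagrams is enforceable. -/
theorem enforceable_of_mem_residual [L.IsCountable] [Countable C] [Nonempty C]
    {S : Set (diagrams T C)} (hS : S ∈ residual (diagrams T C))
    {P : Struct (L.withConsts C) → Prop}
    (hP : ∀ (p : OpenSet L C) (h : Definitive T p), ⟨h.value, h.value_mem_diagrams⟩ ∈ S →
      P h.compiled) : Enforceable T P := by
  obtain ⟨t, htS, ht, htd⟩ := mem_residual.1 hS
  obtain ⟨D, hD, rfl⟩ := ht.eq_iInter_nat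
  have hDd : ∀ n, Dense (D n) := fun n => htd.mono (Set.iInter_subset D n)
  let _ : MetricSpace (diagrams T C) := TopologicalSpace.metrizableSpaceMetric _
  -- The dense open sets `D n` secure membership in the residual set, while the balls of radius `1 /
  -- (n + 1)` make the play converge to one diagram and hence definitive.
  have hext := fun (p : Condition T C) (n : ℕ) =>
    p.exists_extension (hD n) (hDd n) (O := fun v => Metric.ball v (1 / (n + 1)))
      (fun v => Metric.isOpen_ball) (fun v => Metric.mem_ball_self (by positivity))
  choose q hpq hqp hqD c hqc using hext
  -- Player `∃` moves at the even positions `2 * k`, so halving recovers the number of the round.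
  refine ⟨⟨fun k pos => q (pos (Fin.last k)) (k / 2), fun k pos => hpq _ _⟩,
    fun p hp hmove => ?_⟩
  have hmove : ∀ k, p (2 * k + 1) = q (p (2 * k)) k := fun k => by
    simpa using hmove k
  have hmono : Monotone fun n => (p n).expr := monotone_nat_of_le_succ hp
  let K : ℕ → Set (diagrams T C) := fun k => closedDiagrams T (p (2 * k + 1)).expr
  have hKp : ∀ k, K k ⊆ openDiagrams T (p (2 * k)).expr := fun k => by
    simpa only [K, hmove] using hqp (p (2 * k)) k
  have hKD : ∀ k, K k ⊆ D k := fun k => by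
    simpa only [K, hmove] using hqD (p (2 * k)) k
  have hKc : ∀ k, K k ⊆ Metric.ball (c (p (2 * k)) k) (1 / (k + 1)) := fun k => by
    simpa only [K, hmove] using hqc (p (2 * k)) k
  obtain ⟨v, hv⟩ : (⋂ k, K k).Nonempty :=
    IsCompact.nonempty_iInter_of_sequence_nonempty_isCompact_isClosed K
      (fun k => closedDiagrams_anti (hmono (by omega)))
      (fun k => (p _).openDiagrams_nonempty.mono (openDiagrams_subset_closedDiagrams _))
      (isClosed_closedDiagrams _).isCompact fun k => isClosed_closedDiagrams _
  rw [Set.mem_iInter] at hv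
  have hsingle : openDiagrams T (⋃ n, (p n).expr) = {v} := by
    -- Compactness only places `v` in the closed sets. The strict inequalities of stage `n` hold
    -- because the closed set of round `n` lies in the open set of stage `2 * n`.
    refine Set.eq_singleton_iff_unique_mem.2 ⟨fun e he => ?_, fun w hw => ?_⟩
    · obtain ⟨n, hn⟩ := Set.mem_iUnion.1 he
      exact hKp n (hv n) e (hmono (by omega : n ≤ 2 * n) hn)
    · have hwK : ∀ k, w ∈ K k := fun k => openDiagrams_subset_closedDiagrams _
        (openDiagrams_anti (Set.subset_iUnion (fun n => (p n).expr) (2 * k + 1)) hw)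
      have hlim : Tendsto (fun k : ℕ => 1 / ((k : ℝ) + 1) + 1 / (k + 1)) atTop (𝓝 0) := by
        simpa using tendsto_one_div_add_atTop_nhds_zero_nat.add
          (tendsto_one_div_add_atTop_nhds_zero_nat (𝕜 := ℝ))
      refine dist_le_zero.1 (ge_of_tendsto' hlim fun k => ?_)
      exact (dist_triangle_right _ _ _).trans (add_le_add (hKc k (hwK k)).le (hKc k (hv k)).le)
  obtain ⟨hdef, hval⟩ := exists_definitive_of_openDiagrams_eq_singleton hsingle
  refine ⟨hdef, hP _ hdef (htS (Set.mem_iInter.2 fun k => ?_))⟩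
  convert hKD k (hv k)

/-- Finitely many sentences can be forced simultaneously to take their generic values. -/
theorem enforceable_forall_sval_eq [L.IsCountable] [Countable C] [Nonempty C]
    (F : Finset (InfSentence L)) {r : InfSentence L → I}
    (hr : ∀ φ, ∀ᶠ v : diagrams T C in residual _, φ.1.termVal v.1 Fin.elim0 = r φ) :
    Enforceable T fun A : Struct (L.withConsts C) => ∀ φ ∈ F, A.reduct.sval φ.1 = r φ := by
  refine enforceable_of_mem_residual ((eventually_all_finset F).2 fun φ _ => hr φ)
    fun p h hv φ hφ => ?_
  rw [h.sval_compiled]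
  exact hv φ hφ

/-- The sequence in which each entry is computed from the preceding ones. -/
def seqOfPositions {X : Type*} (x : X) (F : (n : ℕ) → (Fin (n + 1) → X) → X) : ℕ → X
  | 0 => x
  | n + 1 => F n fun i => seqOfPositions x F i

/-- Two winning strategies can be played against each other. -/
theorem Enforceable.exists_compiled_and [Nonempty C] {P Q : Struct (L.withConsts C) → Prop}
    (hP : Enforceable T P) (hQ : Enforceable T Q) (hT : T.IsSatisfiable) :
    ∃ A : Struct (L.withConsts C), P A ∧ Q A := by
  obtain ⟨s, hs⟩ := hP
  obtain ⟨s', hs'⟩ := hQ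
  obtain ⟨N, hN⟩ := hT
  let p₀ : Condition T C := ⟨∅, Set.finite_empty, N.expand fun _ => Classical.arbitrary _, hN, by
    simp⟩
  -- The strategy `s` makes the odd entries of the play. The strategy `s'` sees the play without
  -- `p₀`, so that the moves of `s` look to it like moves of Player `∀`. The branch `0` under `else`
  -- is never reached, as `0` is even.
  let F : (n : ℕ) → (Fin (n + 1) → Condition T C) → Condition T C := fun n pos =>
    if Even n then s.move n pos
    else match n, pos with
      | 0, pos => pos 0
      | n + 1, pos => s'.move n fun i => pos i.succ
  let p := seqOfPositions p₀ F
  have hp : ∀ n, p (n + 1) = F n fun i => p i := fun n => by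
    simp only [p]; rw [seqOfPositions]
  have heven : ∀ k, p (2 * k + 1) = s.move (2 * k) fun i => p i := fun k => by
    rw [hp]; exact if_pos (even_two_mul k)
  have hodd : ∀ k, p (2 * k + 1 + 1) = s'.move (2 * k) fun i => p (i + 1) := fun k => by
    rw [hp]; exact if_neg (Nat.not_even_bit1 k)
  have hle : ∀ n, (p n).expr ⊆ (p (n + 1)).expr := fun n => by
    rcases Nat.even_or_odd' n with ⟨k, rfl | rfl⟩
    · rw [heven]; exact s.extends_last (2 * k) fun i => p i
    · rw [hodd]; exact s'.extends_last (2 * k) fun i => p (i + 1)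
  obtain ⟨h, hPA⟩ := hs p hle heven
  have hQ := hs' (fun n => p (n + 1)) (fun n => hle (n + 1)) hodd
  have hunion : ⋃ n, (p (n + 1)).expr = ⋃ n, (p n).expr :=
    (monotone_nat_of_le_succ hle).iSup_nat_add 1
  simp only [Wins] at hQ
  rw [hunion] at hQ
  obtain ⟨h', hQA⟩ := hQ
  exact ⟨h.compiled, hPA, hQA⟩

end Strategies

end ContLogic

theorem mainTheorem11 {L : ContLogic.Signature.{u}} [L.IsCountable]
    {C : Type u} [Countable C] [Infinite C]
    (T : ContLogic.Theory L) (hT : T.IsSatisfiable) (hJEP : T.JEP) :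
    (∀ φ : ContLogic.InfSentence L, ∃! r : unitInterval,
      ContLogic.Enforceable T
        (fun A : ContLogic.Struct (L.withConsts C) => A.reduct.sval φ.1 = r)) ∧
    (ContLogic.finiteForcingCompanion T C).IsComplete := by
  classical
  choose r hr using fun φ : ContLogic.InfSentence L =>
    hJEP.exists_eventually_termVal_eq (C := C) φ.1
  have hF := fun F : Finset (ContLogic.InfSentence L) =>
    ContLogic.enforceable_forall_sval_eq F hr
  have henf : ∀ φ : ContLogic.InfSentence L, ContLogic.Enforceable T
      (fun A : ContLogic.Struct (L.withConsts C) => A.reduct.sval φ.1 = r φ) := fun φ => by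
    simpa using hF {φ}
  have huniq : ∀ (φ : ContLogic.InfSentence L) (s : unitInterval), ContLogic.Enforceable T
      (fun A : ContLogic.Struct (L.withConsts C) => A.reduct.sval φ.1 = s) → s = r φ :=
    fun φ s hs => by
      obtain ⟨A, h1, h2⟩ := hs.exists_compiled_and (henf φ) hT
      exact h1.symm.trans h2
  refine ⟨fun φ => ⟨r φ, henf φ, huniq φ⟩, ?_⟩
  -- Playing the strategy against itself is merely a way to obtain one compiled structure.
  choose A hA using fun F => (hF F).exists_compiled_and (hF F) hT
  -- All continuous functions are connectives, so there are uncountably many sentences, and their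
  -- residual sets cannot simply be intersected. Finite sets of sentences are handled instead and
  -- glued by an ultraproduct.
  obtain ⟨U, π, hU⟩ := ContLogic.exists_isUltraproduct
    (Ultrafilter.of (Filter.atTop : Filter (Finset (ContLogic.InfSentence L))))
    fun F => (A F).reduct
  have hUr : ∀ φ : ContLogic.Sentence L, U.sval φ.1 = r ⟨φ.1, φ.2.isInfFormula⟩ := fun φ =>
    tendsto_nhds_unique (hU.tendsto_sval φ) <| tendsto_const_nhds.congr' <| by
      -- The ultrafilter refines `atTop`, so almost every `F` contains the given sentence.
      filter_upwards [Ultrafilter.of_le _ (Filter.eventually_ge_atTop {⟨φ.1, φ.2.isInfFormula⟩})]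
        with F hF
      exact ((hA F).1 _ (Finset.singleton_subset_iff.1 hF)).symm
  refine ⟨U, Set.ext fun c => ?_⟩
  change ContLogic.Enforceable T _ ↔ U.sval c.1.1 = c.2
  rw [hUr]
  constructor
  · exact fun h => (huniq ⟨c.1.1, c.1.2.isInfFormula⟩ c.2 h).symm
  · exact fun h => h ▸ henf ⟨c.1.1, c.1.2.isInfFormula⟩
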